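/- Let $n\in\mathbb N$, $b>0$, $T>0$, $A\in\mathbb R^{n\times n}$, $g\in L^2(0,T;\mathbb R^n)$, let $\varphi\in H^1(-b,0;\mathbb R^n)$ (identified with its continuous representative on $[-b,0]$), and let $f:\mathbb R^n\to\mathbb R^n$ be continuously differentiable. Assume that there is a constant $\lambda>0$ such that $\langle Df(x)v,v\rangle+\lambda|v|^2\ge 0$ for all $x,v\in\mathbb R^n$. For $\tau\in[0,b]$ consider the delay differential equation \[ \dot x(t)+f(x(t))=A\,x(t-\tau)+g(t)\ \text{ in }(0,T),\qquad x(t)=\varphi(t)\ \text{ in }[-b,0]. \] A solution is a function $x\in C([-b,T],\mathbb R^n)$ with $x|_{[0,T]}\in H^1(0,T;\mathbb R^n)$ and $x|_{[-b,0]}=\varphi$ that satisfies the differential equation for almost every $t\in(0,T)$. Let $\phi(t)=\varphi(t)$ for $t\in[-b,0]$ and $\phi(t)=\varphi(0)$ for $t\in(0,T]$, and let $H^1_{[0]}(-b,T;\mathbb R^n)$ be the subspace, with the $H^1$ norm, of all $z\in H^1(-b,T;\mathbb R^n)$ with $z=0$ on $[-b,0]$. Then for every $\tau\in[0,b]$ the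 equation has a unique solution $x[\tau]$, the function $z[\tau]:=x[\tau]-\phi$ belongs to $H^1_{[0]}(-b,T;\mathbb R^n)$, and the mapping $\tau\mapsto z[\tau]$ is continuously differentiable from $[0,b]$ to $H^1_{[0]}(-b,T;\mathbb R^n)$ (with one-sided derivatives at the end points $0$ and $b$). -/

import Mathlib

open MeasureTheory Set
open scoped ContDiff

noncomputable section

/-- `ℝⁿ` with its Euclidean norm. -/
abbrev Vec (n : ℕ) : Type := EuclideanSpace ℝ (Fin n)

/-- Lebesgue measure on the open interval `(a, c)`. -/
abbrev volOn (a c : ℝ) : Measure ℝ := volume.restrict (Ioo a c)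

/-- `v` is the weak (distributional) derivative of `u` on `(a, c)`: for every test function
`ψ ∈ C_c^∞(a, c)` one has `∫ ψ' u = - ∫ ψ v`. It is only used for `u` and `v` in `L²(a, c)`. -/
def HasWeakDeriv {n : ℕ} (a c : ℝ) (u v : ℝ → Vec n) : Prop :=
  ∀ ψ : ℝ → ℝ, ContDiff ℝ ∞ ψ → HasCompactSupport ψ → tsupport ψ ⊆ Ioo a c →
    ∫ t, deriv ψ t • u t ∂(volOn a c) = - ∫ t, ψ t • v t ∂(volOn a c)

/-- The function `u` and its weak derivative `v` are both in `L²(a, c; ℝⁿ)`. -/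
structure IsH1Pair {n : ℕ} (a c : ℝ) (u v : ℝ → Vec n) : Prop where
  memLp : MemLp u 2 (volOn a c)
  memLp_deriv : MemLp v 2 (volOn a c)
  weakDeriv : HasWeakDeriv a c u v

/-- The function `u` belongs to `H¹(a, c; ℝⁿ)`. -/
def MemH1 {n : ℕ} (a c : ℝ) (u : ℝ → Vec n) : Prop :=
  ∃ v : ℝ → Vec n, IsH1Pair a c u v

/-- The Hilbert space `L²(a, c; ℝⁿ)`. -/
abbrev L2 (n : ℕ) (a c : ℝ) : Type := Lp (Vec n) 2 (volOn a c)

theorem integrable_test_smul {n : ℕ} {a c : ℝ} (u : L2 n a c) {ψ : ℝ → ℝ}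
    (hc : Continuous ψ) (hs : HasCompactSupport ψ) :
    Integrable (fun t => ψ t • u t) (volOn a c) := by
  obtain ⟨C, hC⟩ := hs.exists_bound_of_continuous hc
  have hu : Integrable (u : ℝ → Vec n) (volOn a c) := (Lp.memLp u).integrable (by norm_num)
  exact hu.bdd_smul C hc.aestronglyMeasurable (Filter.Eventually.of_forall hC)

/-- The Sobolev space `H¹(a, c; ℝⁿ)`, as the space of all pairs `(u, u̇)` in `L² × L²` for which
`u̇` is the weak derivative of `u` (`u̇` is determined by `u`). The norm, inherited from the `ℓ²`
product, is the usual one, `‖u‖² = ‖u‖²_{L²} + ‖u̇‖²_{L²}`. -/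
def H1 (n : ℕ) (a c : ℝ) : Submodule ℝ (WithLp 2 (L2 n a c × L2 n a c)) where
  carrier := {p | HasWeakDeriv a c p.fst p.snd}
  zero_mem' := by
    intro ψ _ _ _
    have h0 : ((0 : L2 n a c) : ℝ → Vec n) =ᵐ[volOn a c] 0 := Lp.coeFn_zero _ _ _
    have h1 (χ : ℝ → ℝ) : ∫ t, χ t • (0 : L2 n a c) t ∂(volOn a c) = 0 := by
      apply integral_eq_zero_of_ae
      filter_upwards [h0] with t ht
      rw [ht, Pi.zero_apply, smul_zero]
    rw [WithLp.zero_fst, WithLp.zero_snd, h1, h1, neg_zero]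
  add_mem' := by
    intro p q hp hq ψ h1 h2 h3
    have e (u v : L2 n a c) {χ : ℝ → ℝ} (hc : Continuous χ) (hs : HasCompactSupport χ) :
        ∫ t, χ t • (u + v) t ∂(volOn a c)
          = ∫ t, χ t • u t ∂(volOn a c) + ∫ t, χ t • v t ∂(volOn a c) := by
      rw [← integral_add (integrable_test_smul u hc hs) (integrable_test_smul v hc hs)]
      apply integral_congr_ae
      filter_upwards [Lp.coeFn_add u v] with t ht
      rw [ht, Pi.add_apply, smul_add]
    rw [WithLp.add_fst, WithLp.add_snd, e _ _ (h1.continuous_deriv (by simp)) h2.deriv,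
      e _ _ h1.continuous h2, hp ψ h1 h2 h3, hq ψ h1 h2 h3, neg_add]
  smul_mem' := by
    intro r p hp ψ h1 h2 h3
    have e (u : L2 n a c) (χ : ℝ → ℝ) :
        ∫ t, χ t • (r • u) t ∂(volOn a c) = r • ∫ t, χ t • u t ∂(volOn a c) := by
      rw [← integral_smul]
      apply integral_congr_ae
      filter_upwards [Lp.coeFn_smul r u] with t ht
      rw [ht, Pi.smul_apply, smul_comm]
    rw [WithLp.smul_fst, WithLp.smul_snd, e, e, hp ψ h1 h2 h3, smul_neg]

/-- The subspace `H¹_{[0]}(-b, T; ℝⁿ)` of all `z ∈ H¹(-b, T; ℝⁿ)` that vanish on `[-b, 0]`.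
(The continuous representative of `z` vanishes at every point of `[-b, 0]` if and only if `z`
vanishes almost everywhere in `(-b, 0)`.) -/
def H1Zero (n : ℕ) (b T : ℝ) : Submodule ℝ (H1 n (-b) T) where
  carrier := {z | ∀ᵐ t ∂(volOn (-b) T), t ≤ 0 → z.1.fst t = 0}
  zero_mem' := by
    filter_upwards [Lp.coeFn_zero (Vec n) 2 (volOn (-b) T)] with t ht _
    exact ht
  add_mem' := by
    intro z w hz hw
    filter_upwards [hz, hw, Lp.coeFn_add z.1.fst w.1.fst] with t h1 h2 h3 ht
    change (z.1.fst + w.1.fst : L2 n (-b) T) t = 0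
    rw [h3, Pi.add_apply, h1 ht, h2 ht, add_zero]
  smul_mem' := by
    intro r z hz
    filter_upwards [hz, Lp.coeFn_smul r z.1.fst] with t h1 h2 ht
    change (r • z.1.fst : L2 n (-b) T) t = 0
    rw [h2, Pi.smul_apply, h1 ht, smul_zero]

/-- `x` is a solution of the delay equation
`ẋ(t) + f(x(t)) = A x(t - τ) + g(t)` in `(0, T)`, `x = φ` on `[-b, 0]`: it is continuous on
`[-b, T]`, its restriction to `[0, T]` is in `H¹`, it coincides with `φ` on `[-b, 0]`, and the
equation holds almost everywhere in `(0, T)`. -/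
def IsDelaySolution {n : ℕ} (f : Vec n → Vec n) (A : Matrix (Fin n) (Fin n) ℝ)
    (g φ : ℝ → Vec n) (b T τ : ℝ) (x : ℝ → Vec n) : Prop :=
  ContinuousOn x (Icc (-b) T) ∧ EqOn x φ (Icc (-b) 0) ∧
    ∃ v : ℝ → Vec n, IsH1Pair 0 T x v ∧
      ∀ᵐ t ∂(volOn 0 T), v t + f (x t) = A.toEuclideanLin (x (t - τ)) + g t

/-- The extension of `φ : [-b, 0] → ℝⁿ` to `[-b, T]` by the constant `φ(0)` on `(0, T]`. -/
def extendInitial {n : ℕ} (φ : ℝ → Vec n) (t : ℝ) : Vec n := if t ≤ 0 then φ t else φ 0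

end

/-! The unknown is `v = ẋ` on `(0, T)` in `L²(0, T)`, so that `x(t) = φ(0) + ∫₀ᵗ v` for `t ≥ 0`.
With `p` the derivative of the history extended by zero, the delayed state is `x(t - τ) = φ(0) +
∫₀^{t-τ} (p + v)`, and the equation becomes one equation `delayResidual = 0` in `L²(0, T)` with
parameter `τ`, to which the implicit function theorem is applied.

The main point is that the residual is jointly C¹ in `(τ, v)`. Translation of an `L²` function is
only strongly continuous in the shift, but here the translated function is a primitive: `∫₀^{t-τ} ψ
= ∫₀ᵗ ψ - ∫₀^τ ψ(t - r) dr`. Its `τ`-derivative `-ψ(· - τ)` is jointly continuous in `(τ, ψ)`, and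
its `ψ`-derivative is Lipschitz in `τ` in operator norm (`contDiff_delayPrimitive`). This is where
`φ ∈ H¹` enters. The nonlinearity acts on primitives, hence on bounded continuous functions with the
sup norm, where superposition by a compactly supported C¹ map is C¹ (`contDiff_superposition`).

The linearization in `v` is the identity plus a retarded Volterra operator, hence bijective, and the
nonlinear equation is uniquely solvable for the same reason: some iterate of the fixed point map is
a contraction (`existsUnique_primitive_eq`). By uniqueness the solutions coincide near each `τ` with
the implicit function, and `v ↦ z` is bounded linear into `H¹_{[0]}`.

Since `f` need not be globally Lipschitz, it is cut off. The one-sided condition gives `⟨f(x), x⟩ ≥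
-(|f(0)||x| + λ|x|²)`, which survives the cutoff and yields a bound on `|x|` independent of `τ` and
of the cutoff (`exists_trajectory_bound`). With a cutoff radius equal to this bound, `f` and its
truncation have the same solutions. -/

noncomputable section

open Filter Topology BoundedContinuousFunction

/-! ### Primitives, restrictions and translations on `L²` -/

section Operators

variable {E : Type*} [NormedAddCommGroup E]

theorem integrable_of_memLp_two {a c : ℝ} {v : ℝ → E} (hv : MemLp v 2 (volOn a c)) :
    Integrable v (volOn a c) :=
  hv.integrable (by norm_num)

theorem Lp.integrable_volOn {a c : ℝ} (v : Lp E 2 (volOn a c)) : Integrable v (volOn a c) :=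
  integrable_of_memLp_two (Lp.memLp v)

/-- Hölder's inequality for the embedding of `L²` into `L¹` on a finite measure space. -/
theorem integral_norm_le_mul_norm {μ : Measure ℝ} [IsFiniteMeasure μ] (v : Lp E 2 μ) :
    ∫ s, ‖v s‖ ∂μ ≤ (μ univ ^ (1 / 2 : ℝ)).toReal * ‖v‖ := by
  have h := eLpNorm_le_eLpNorm_mul_rpow_measure_univ (p := 1) (q := 2) (μ := μ)
    (by norm_num) (Lp.aestronglyMeasurable v)
  have e : (1 / (1 : ENNReal).toReal - 1 / (2 : ENNReal).toReal) = (1 / 2 : ℝ) := by norm_num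
  rw [e] at h
  have hfin : μ univ ^ (1 / 2 : ℝ) ≠ ⊤ :=
    ENNReal.rpow_ne_top_of_nonneg (by norm_num) (measure_ne_top _ _)
  rw [integral_norm_eq_lintegral_enorm (Lp.aestronglyMeasurable v), ← eLpNorm_one_eq_lintegral_enorm,
    Lp.norm_def, mul_comm, ← ENNReal.toReal_mul]
  exact ENNReal.toReal_mono (ENNReal.mul_ne_top (Lp.eLpNorm_ne_top v) hfin) h

theorem Lp.intervalIntegrable_volume (ψ : Lp E 2 (volume : Measure ℝ)) (a b : ℝ) :
    IntervalIntegrable ψ volume a b :=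
  ⟨((Lp.memLp ψ).restrict _).integrable (by norm_num),
    ((Lp.memLp ψ).restrict _).integrable (by norm_num)⟩

variable [NormedSpace ℝ E]

/-- Extension by zero of functions in `L²(a, c)` to the whole line. -/
def extendZero (a c : ℝ) : Lp E 2 (volOn a c) →ₗᵢ[ℝ] Lp E 2 (volume : Measure ℝ) where
  toFun v := ((memLp_indicator_iff_restrict measurableSet_Ioo).2 (Lp.memLp v)).toLp
    ((Ioo a c).indicator v)
  map_add' v w := by
    rw [← MemLp.toLp_add]
    apply MemLp.toLp_congr
    have := ae_imp_of_ae_restrict (Lp.coeFn_add v w)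
    filter_upwards [this] with t ht
    by_cases h : t ∈ Ioo a c
    · simpa [h] using ht h
    · simp [h]
  map_smul' r v := by
    rw [RingHom.id_apply, ← MemLp.toLp_const_smul]
    apply MemLp.toLp_congr
    have := ae_imp_of_ae_restrict (Lp.coeFn_smul r v)
    filter_upwards [this] with t ht
    by_cases h : t ∈ Ioo a c
    · simp [h, ht h]
    · simp [h]
  norm_map' v := by
    change ‖((memLp_indicator_iff_restrict measurableSet_Ioo).2 (Lp.memLp v)).toLp
      ((Ioo a c).indicator v)‖ = _
    rw [Lp.norm_toLp, eLpNorm_indicator_eq_eLpNorm_restrict measurableSet_Ioo, Lp.norm_def]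

theorem extendZero_apply {a c : ℝ} (v : Lp E 2 (volOn a c)) :
    extendZero a c v = ((memLp_indicator_iff_restrict measurableSet_Ioo).2 (Lp.memLp v)).toLp
      ((Ioo a c).indicator v) := rfl

theorem coeFn_extendZero {a c : ℝ} (v : Lp E 2 (volOn a c)) :
    extendZero a c v =ᵐ[volume] (Ioo a c).indicator v :=
  (extendZero_apply v).symm ▸ MemLp.coeFn_toLp _

/-- Restriction of functions in `L²(ℝ)` to `(a, c)`. -/
def restrictL2 (a c : ℝ) : Lp E 2 (volume : Measure ℝ) →L[ℝ] Lp E 2 (volOn a c) :=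
  LpToLpRestrictCLM ℝ E ℝ volume 2 (Ioo a c)

theorem coeFn_restrictL2 {a c : ℝ} (v : Lp E 2 (volume : Measure ℝ)) :
    restrictL2 a c v =ᵐ[volOn a c] v :=
  LpToLpRestrictCLM_coeFn ℝ (Ioo a c) v

theorem norm_restrictL2_le {a c : ℝ} (v : Lp E 2 (volume : Measure ℝ)) :
    ‖restrictL2 a c v‖ ≤ ‖v‖ :=
  norm_Lp_toLp_restrict_le _ _

theorem norm_intervalIntegral_le_integral_norm {μ : Measure ℝ} {f : ℝ → E} (hf : Integrable f μ)
    (a b : ℝ) : ‖∫ s in a..b, f s ∂μ‖ ≤ ∫ s, ‖f s‖ ∂μ :=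
  intervalIntegral.norm_integral_le_integral_norm_uIoc.trans
    (setIntegral_le_integral hf.norm (.of_forall fun _ => norm_nonneg _))

/-- The primitive `t ↦ ∫₀ᵗ v` of a function in `L²(a, c)`, extended by zero. -/
def primitive (a c : ℝ) : Lp E 2 (volOn a c) →L[ℝ] (ℝ →ᵇ E) :=
  LinearMap.mkContinuous
    { toFun v := BoundedContinuousFunction.ofNormedAddCommGroup
        (fun t => ∫ s in (0 : ℝ)..t, v s ∂(volOn a c))
        (intervalIntegral.continuous_primitive
          (fun _ _ => (Lp.integrable_volOn v).intervalIntegrable) 0)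
        (∫ s, ‖v s‖ ∂(volOn a c))
        (fun t => norm_intervalIntegral_le_integral_norm (Lp.integrable_volOn v) 0 t)
      map_add' v w := by
        ext t
        change ∫ s in (0 : ℝ)..t, (v + w) s ∂(volOn a c) =
          ∫ s in (0 : ℝ)..t, v s ∂(volOn a c) + ∫ s in (0 : ℝ)..t, w s ∂(volOn a c)
        rw [← intervalIntegral.integral_add (Lp.integrable_volOn v).intervalIntegrable
          (Lp.integrable_volOn w).intervalIntegrable]
        refine intervalIntegral.integral_congr_ae ?_
        filter_upwards [Lp.coeFn_add v w] with s hs _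
        exact hs
      map_smul' r v := by
        ext t
        change ∫ s in (0 : ℝ)..t, (r • v) s ∂(volOn a c) =
          r • ∫ s in (0 : ℝ)..t, v s ∂(volOn a c)
        rw [← intervalIntegral.integral_smul]
        refine intervalIntegral.integral_congr_ae ?_
        filter_upwards [Lp.coeFn_smul r v] with s hs _
        exact hs }
    ((volOn a c univ ^ (1 / 2 : ℝ)).toReal)
    (fun v => (BoundedContinuousFunction.norm_le (by positivity)).2 fun t =>
      (norm_intervalIntegral_le_integral_norm (Lp.integrable_volOn v) 0 t).trans
        (integral_norm_le_mul_norm v))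

theorem primitive_apply {a c : ℝ} (v : Lp E 2 (volOn a c)) (t : ℝ) :
    primitive a c v t = ∫ s in (0 : ℝ)..t, v s ∂(volOn a c) := rfl

theorem intervalIntegral_volOn {a c : ℝ} {f : ℝ → E} (x y : ℝ) :
    ∫ s in x..y, f s ∂(volOn a c) = ∫ s in x..y, (Ioo a c).indicator f s := by
  simp only [intervalIntegral, volOn]
  rw [Measure.restrict_restrict measurableSet_Ioc, Measure.restrict_restrict measurableSet_Ioc,
    setIntegral_indicator measurableSet_Ioo, setIntegral_indicator measurableSet_Ioo]

theorem primitive_eq_extendZero {a c : ℝ} (v : Lp E 2 (volOn a c)) (t : ℝ) :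
    primitive a c v t = ∫ s in (0 : ℝ)..t, extendZero a c v s := by
  rw [primitive_apply, intervalIntegral_volOn]
  refine intervalIntegral.integral_congr_ae ?_
  filter_upwards [coeFn_extendZero v] with s hs _
  exact hs.symm

theorem intervalIntegral_volOn_of_mem {a c x y : ℝ} {f : ℝ → E} (hx : x ∈ Icc a c)
    (hy : y ∈ Icc a c) : ∫ s in x..y, f s ∂(volOn a c) = ∫ s in x..y, f s := by
  rw [intervalIntegral_volOn]
  refine intervalIntegral.integral_congr_ae ?_
  have h1 : ∀ᵐ s : ℝ, s ≠ a := by simp [ae_iff]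
  have h2 : ∀ᵐ s : ℝ, s ≠ c := by simp [ae_iff]
  filter_upwards [h1, h2] with s h1 h2 hs
  have : s ∈ Icc a c := uIcc_subset_Icc hx hy (uIoc_subset_uIcc hs)
  have hs' : s ∈ Ioo a c := ⟨lt_of_le_of_ne this.1 h1.symm, lt_of_le_of_ne this.2 h2⟩
  exact indicator_of_mem hs' _

theorem primitive_zero_left {T t : ℝ} (v : Lp E 2 (volOn 0 T)) (ht : t ≤ 0) :
    primitive 0 T v t = 0 := by
  rw [primitive_apply, intervalIntegral_volOn, intervalIntegral.integral_symm,
    intervalIntegral.integral_of_le ht, neg_eq_zero, setIntegral_eq_zero_of_forall_eq_zero]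
  intro s hs
  exact indicator_of_notMem (fun h => absurd h.1 (not_lt.2 hs.2)) _

theorem primitive_of_ge {T t : ℝ} (v : Lp E 2 (volOn 0 T)) (ht : T ≤ t) :
    primitive 0 T v t = primitive 0 T v T := by
  rw [primitive_apply, primitive_apply, ← sub_eq_zero,
    intervalIntegral.integral_interval_sub_left (Lp.integrable_volOn v).intervalIntegrable
      (Lp.integrable_volOn v).intervalIntegrable, intervalIntegral_volOn,
    intervalIntegral.integral_of_le ht, setIntegral_eq_zero_of_forall_eq_zero]
  intro s hs
  exact indicator_of_notMem (fun h => absurd h.2 (not_lt.2 hs.1.le)) _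

/-- Bounded continuous functions as elements of `L²(a, c)`. -/
abbrev bcfToL2 (a c : ℝ) : (ℝ →ᵇ E) →L[ℝ] Lp E 2 (volOn a c) :=
  BoundedContinuousFunction.toLp 2 (volOn a c) ℝ

theorem coeFn_bcfToL2 {a c : ℝ} (u : ℝ →ᵇ E) : bcfToL2 a c u =ᵐ[volOn a c] u :=
  BoundedContinuousFunction.coeFn_toLp 2 (volOn a c) ℝ u

/-- The shift `ψ ↦ ψ(· - r)` on `L²(ℝ)`. -/
def shift (r : ℝ) : Lp E 2 (volume : Measure ℝ) →ₗᵢ[ℝ] Lp E 2 (volume : Measure ℝ) :=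
  Lp.compMeasurePreservingₗᵢ ℝ (fun t => t - r) (measurePreserving_sub_right volume r)

theorem coeFn_shift (r : ℝ) (ψ : Lp E 2 (volume : Measure ℝ)) :
    shift r ψ =ᵐ[volume] fun t => ψ (t - r) :=
  Lp.coeFn_compMeasurePreserving ψ (measurePreserving_sub_right volume r)

/-- Strong continuity of translations on `L²`, jointly with the function. Continuity in operator
norm fails in general, so the shift itself cannot serve as a C¹ family. -/
theorem continuous_shift :
    Continuous fun q : ℝ × Lp E 2 (volume : Measure ℝ) => shift q.1 q.2 := by
  let g : ℝ × Lp E 2 (volume : Measure ℝ) → C(ℝ, ℝ) := fun q => ⟨fun t => t - q.1, by fun_prop⟩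
  have hg : Continuous g := by
    refine ContinuousMap.continuous_of_continuous_uncurry _ ?_
    change Continuous fun p : (ℝ × Lp E 2 (volume : Measure ℝ)) × ℝ => p.2 - p.1.1
    fun_prop
  exact continuous_snd.compMeasurePreservingLp hg
    (fun q => measurePreserving_sub_right volume q.1) (by norm_num)

/-- The restriction to `(0, T)` of the shift by `r`. -/
def shiftRestrict (T r : ℝ) : Lp E 2 (volume : Measure ℝ) →L[ℝ] Lp E 2 (volOn 0 T) :=
  (restrictL2 0 T).comp (shift r).toContinuousLinearMap

theorem continuous_shiftRestrict (T : ℝ) :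
    Continuous fun q : ℝ × Lp E 2 (volume : Measure ℝ) => shiftRestrict T q.1 q.2 :=
  (restrictL2 0 T).continuous.comp continuous_shift

theorem norm_shift (r : ℝ) (ψ : Lp E 2 (volume : Measure ℝ)) : ‖shift r ψ‖ = ‖ψ‖ :=
  (shift r).norm_map ψ

theorem shiftRestrict_apply (T r : ℝ) (ψ : Lp E 2 (volume : Measure ℝ)) :
    shiftRestrict T r ψ = restrictL2 0 T (shift r ψ) := rfl

theorem norm_shiftRestrict_le (T r : ℝ) (ψ : Lp E 2 (volume : Measure ℝ)) :
    ‖shiftRestrict T r ψ‖ ≤ ‖ψ‖ := by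
  rw [shiftRestrict_apply, ← norm_shift r ψ]
  exact norm_restrictL2_le _

theorem coeFn_shiftRestrict (T r : ℝ) (ψ : Lp E 2 (volume : Measure ℝ)) :
    shiftRestrict T r ψ =ᵐ[volOn 0 T] fun t => ψ (t - r) := by
  have h1 : restrictL2 0 T (shift r ψ) =ᵐ[volOn 0 T] shift r ψ := coeFn_restrictL2 _
  have h2 : shift r ψ =ᵐ[volOn 0 T] fun t => ψ (t - r) := ae_restrict_of_ae (coeFn_shift r ψ)
  rw [shiftRestrict_apply]
  filter_upwards [h1, h2] with t h1 h2
  rw [h1, h2]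

theorem continuous_shiftRestrict_left (T : ℝ) (ψ : Lp E 2 (volume : Measure ℝ)) :
    Continuous fun r => shiftRestrict T r ψ := by
  have h : Continuous fun r : ℝ => (r, ψ) := by fun_prop
  have h' := (continuous_shiftRestrict (E := E) T).comp h
  exact h'

end Operators

/-! ### C¹ dependence of a delayed primitive on the delay -/

section DelayPrimitive

variable {E : Type*} [NormedAddCommGroup E]

/-- The translates of a compactly supported continuous function depend continuously on the shift. -/
theorem continuous_bcf_translate {u : ℝ → E} (hu : Continuous u) (hs : HasCompactSupport u)
    {C : ℝ} (hC : ∀ t, ‖u t‖ ≤ C) :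
    Continuous fun r : ℝ => BoundedContinuousFunction.ofNormedAddCommGroup
      (fun t => u (t - r)) (by fun_prop) C (fun t => hC _) := by
  rw [Metric.continuous_iff]
  intro r ε hε
  obtain ⟨δ, hδ, h⟩ := Metric.uniformContinuous_iff.1
    (hs.uniformContinuous_of_continuous hu) (ε / 2) (half_pos hε)
  refine ⟨δ, hδ, fun q hq => ?_⟩
  refine lt_of_le_of_lt ((BoundedContinuousFunction.dist_le (half_pos hε).le).2 fun t => ?_)
    (half_lt_self hε)
  refine (h ?_).le
  rw [Real.dist_eq] at hq ⊢
  rwa [show t - q - (t - r) = -(q - r) by ring, abs_neg]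

variable [NormedSpace ℝ E]

theorem primitive_restrictL2 {T t : ℝ} (ψ : Lp E 2 (volume : Measure ℝ)) (ht : t ∈ Icc 0 T) :
    primitive 0 T (restrictL2 0 T ψ) t = ∫ s in (0 : ℝ)..t, ψ s := by
  rw [primitive_apply, ← intervalIntegral_volOn_of_mem (left_mem_Icc.2 (ht.1.trans ht.2)) ht]
  refine intervalIntegral.integral_congr_ae ?_
  have h : restrictL2 0 T ψ =ᵐ[volOn 0 T] ψ := coeFn_restrictL2 ψ
  filter_upwards [h] with s hs _
  exact hs

/-- The operator `ψ ↦ ∫₀^τ ψ(· - r) dr` from `L²(ℝ)` to `L²(0, T)`. -/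
def shiftIntegral (T τ : ℝ) : Lp E 2 (volume : Measure ℝ) →L[ℝ] Lp E 2 (volOn 0 T) :=
  LinearMap.mkContinuous
    { toFun ψ := ∫ r in (0 : ℝ)..τ, shiftRestrict T r ψ
      map_add' ψ χ := by
        simp only [map_add]
        exact intervalIntegral.integral_add
          ((continuous_shiftRestrict_left T ψ).intervalIntegrable _ _)
          ((continuous_shiftRestrict_left T χ).intervalIntegrable _ _)
      map_smul' c ψ := by
        simp only [map_smul, RingHom.id_apply]
        exact intervalIntegral.integral_smul c _ }
    |τ|
    (fun ψ => by
      have h := intervalIntegral.norm_integral_le_of_norm_le_const (a := 0) (b := τ) (C := ‖ψ‖)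
        (f := fun r => shiftRestrict T r ψ) (fun r _ => norm_shiftRestrict_le T r ψ)
      rw [sub_zero, mul_comm] at h
      exact h)

theorem shiftIntegral_apply (T τ : ℝ) (ψ : Lp E 2 (volume : Measure ℝ)) :
    shiftIntegral T τ ψ = ∫ r in (0 : ℝ)..τ, shiftRestrict T r ψ := rfl

/-- The difference integrates contractions over an interval of length `|τ - σ|`. Integration in the
shift thus gives the operator-norm continuity that the shift lacks. -/
theorem norm_shiftIntegral_sub_le (T τ σ : ℝ) :
    ‖(shiftIntegral T τ : Lp E 2 (volume : Measure ℝ) →L[ℝ] Lp E 2 (volOn 0 T)) -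
      shiftIntegral T σ‖ ≤ |τ - σ| := by
  refine ContinuousLinearMap.opNorm_le_bound _ (abs_nonneg _) fun ψ => ?_
  rw [_root_.sub_apply, shiftIntegral_apply, shiftIntegral_apply,
    intervalIntegral.integral_interval_sub_left
      ((continuous_shiftRestrict_left T ψ).intervalIntegrable _ _)
      ((continuous_shiftRestrict_left T ψ).intervalIntegrable _ _), mul_comm]
  exact intervalIntegral.norm_integral_le_of_norm_le_const
    fun r _ => norm_shiftRestrict_le T r ψ

theorem continuous_shiftIntegral (T : ℝ) :
    Continuous fun τ =>
      (shiftIntegral T τ : Lp E 2 (volume : Measure ℝ) →L[ℝ] Lp E 2 (volOn 0 T)) := by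
  have : LipschitzWith 1 fun τ =>
      (shiftIntegral T τ : Lp E 2 (volume : Measure ℝ) →L[ℝ] Lp E 2 (volOn 0 T)) :=
    LipschitzWith.of_dist_le_mul fun τ σ => by
      rw [dist_eq_norm, NNReal.coe_one, one_mul, Real.dist_eq]
      exact norm_shiftIntegral_sub_le T τ σ
  exact this.continuous

theorem hasDerivAt_shiftIntegral [CompleteSpace E] (T τ : ℝ) (ψ : Lp E 2 (volume : Measure ℝ)) :
    HasDerivAt (fun σ => shiftIntegral T σ ψ) (shiftRestrict T τ ψ) τ := by
  have h := continuous_shiftRestrict_left T ψ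
  exact intervalIntegral.integral_hasDerivAt_right (h.intervalIntegrable _ _)
    (h.stronglyMeasurableAtFilter _ _) h.continuousAt

/-- Both partial derivatives exist and are continuous in `(τ, ψ)`: the one in `τ` is the shifted
function, by the fundamental theorem of calculus, and the one in `ψ` is the operator itself. -/
theorem hasStrictFDerivAt_shiftIntegral [CompleteSpace E] (T : ℝ)
    (q : ℝ × Lp E 2 (volume : Measure ℝ)) :
    HasStrictFDerivAt (fun q : ℝ × Lp E 2 (volume : Measure ℝ) => shiftIntegral T q.1 q.2)
      ((ContinuousLinearMap.toSpanSingleton ℝ (shiftRestrict T q.1 q.2)).coprod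
        (shiftIntegral T q.1)) q := by
  refine hasStrictFDerivAt_uncurry_coprod
    (f := fun τ (ψ : Lp E 2 (volume : Measure ℝ)) => shiftIntegral T τ ψ)
    (f₁ := fun τ ψ => ContinuousLinearMap.toSpanSingleton ℝ (shiftRestrict T τ ψ))
    (f₂ := fun τ _ => shiftIntegral T τ) ?_ ?_ ?_ ?_
  · exact .of_forall fun v => (hasDerivAt_shiftIntegral T v.1 v.2).hasFDerivAt
  · exact .of_forall fun v => (shiftIntegral T v.1).hasFDerivAt
  · have h1 := continuous_shiftRestrict (E := E) T
    have h2 := (ContinuousLinearMap.toSpanSingletonCLE (𝕜 := ℝ)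
      (E := Lp E 2 (volOn 0 T))).continuous.comp h1
    exact h2.continuousAt
  · have h1 := (continuous_shiftIntegral (E := E) T).comp
      (continuous_fst (X := ℝ) (Y := Lp E 2 (volume : Measure ℝ)))
    exact h1.continuousAt

theorem contDiff_shiftIntegral [CompleteSpace E] (T : ℝ) :
    ContDiff ℝ 1 fun q : ℝ × Lp E 2 (volume : Measure ℝ) => shiftIntegral T q.1 q.2 := by
  rw [contDiff_one_iff_hasFDerivAt]
  refine ⟨_, ?_, fun q => (hasStrictFDerivAt_shiftIntegral T q).hasFDerivAt⟩
  have h1 := (ContinuousLinearMap.toSpanSingletonCLE (𝕜 := ℝ)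
      (E := Lp E 2 (volOn 0 T))).continuous.comp (continuous_shiftRestrict (E := E) T)
  have h2 := (continuous_shiftIntegral (E := E) T).comp
      (continuous_fst (X := ℝ) (Y := Lp E 2 (volume : Measure ℝ)))
  exact (ContinuousLinearMap.coprodEquivL (𝕜 := ℝ) ℝ).continuous.comp (h1.prodMk h2)

/-- The function `t ↦ ∫₀^{t - τ} ψ` as an element of `L²(0, T)`, written in such a way that its
dependence on `τ` is explicit. -/
def delayPrimitive (T τ : ℝ) : Lp E 2 (volume : Measure ℝ) →L[ℝ] Lp E 2 (volOn 0 T) :=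
  ((bcfToL2 0 T).comp (primitive 0 T)).comp (restrictL2 0 T) - shiftIntegral T τ

theorem delayPrimitive_apply (T τ : ℝ) (ψ : Lp E 2 (volume : Measure ℝ)) :
    delayPrimitive T τ ψ =
      bcfToL2 0 T (primitive 0 T (restrictL2 0 T ψ)) - shiftIntegral T τ ψ := rfl

theorem contDiff_delayPrimitive [CompleteSpace E] (T : ℝ) :
    ContDiff ℝ 1 fun q : ℝ × Lp E 2 (volume : Measure ℝ) => delayPrimitive T q.1 q.2 := by
  have h := (((bcfToL2 0 T).comp (primitive 0 T)).comp
    (restrictL2 (E := E) 0 T)).contDiff (n := 1)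
  exact (h.comp contDiff_snd).sub (contDiff_shiftIntegral T)

theorem norm_integral_le_of_subset_Icc (ψ : Lp E 2 (volume : Measure ℝ)) {a b x y : ℝ}
    (hx : x ∈ Icc a b) (hy : y ∈ Icc a b) :
    ‖∫ s in x..y, ψ s‖ ≤ (volOn a b univ ^ (1 / 2 : ℝ)).toReal * ‖ψ‖ := by
  have h : restrictL2 a b ψ =ᵐ[volOn a b] ψ := coeFn_restrictL2 ψ
  have e : ∫ s in x..y, ψ s = ∫ s in x..y, restrictL2 a b ψ s ∂(volOn a b) := by
    rw [← intervalIntegral_volOn_of_mem hx hy]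
    refine intervalIntegral.integral_congr_ae ?_
    filter_upwards [h] with s hs _
    exact hs.symm
  rw [e]
  refine (norm_intervalIntegral_le_integral_norm (Lp.integrable_volOn _) x y).trans ?_
  refine (integral_norm_le_mul_norm _).trans ?_
  gcongr
  exact norm_restrictL2_le ψ

theorem tendsto_intervalIntegral_of_tendsto_L2 {ψ : ℕ → Lp E 2 (volume : Measure ℝ)}
    {χ : Lp E 2 (volume : Measure ℝ)} (h : Tendsto ψ atTop (𝓝 χ)) (x y : ℝ) :
    Tendsto (fun k => ∫ s in x..y, ψ k s) atTop (𝓝 (∫ s in x..y, χ s)) := by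
  rw [tendsto_iff_norm_sub_tendsto_zero] at h ⊢
  have hb (k : ℕ) : ‖(∫ s in x..y, ψ k s) - ∫ s in x..y, χ s‖ ≤
      (volOn (min x y) (max x y) univ ^ (1 / 2 : ℝ)).toReal * ‖ψ k - χ‖ := by
    have hsub : (∫ s in x..y, ψ k s) - ∫ s in x..y, χ s = ∫ s in x..y, (ψ k - χ) s := by
      rw [← intervalIntegral.integral_sub (Lp.intervalIntegrable_volume _ _ _)
        (Lp.intervalIntegrable_volume _ _ _)]
      refine intervalIntegral.integral_congr_ae ?_
      filter_upwards [Lp.coeFn_sub (ψ k) χ] with s hs _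
      exact hs.symm
    rw [hsub]
    exact norm_integral_le_of_subset_Icc _ ⟨min_le_left _ _, le_max_left _ _⟩
      ⟨min_le_right _ _, le_max_right _ _⟩
  refine squeeze_zero (fun _ => norm_nonneg _) hb ?_
  simpa using h.const_mul _

/-- An `L²`-valued integral cannot be evaluated at a point. For this `u` the translates are
continuous in the sup norm, where evaluation is a bounded functional and commutes with the integral;
the substitution `s = t - r` then finishes. -/
theorem coeFn_delayPrimitive_of_continuous [CompleteSpace E] (T τ : ℝ) {u : ℝ → E} (hu : Continuous u)
    (hs : HasCompactSupport u) (hu2 : MemLp u 2 volume) :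
    delayPrimitive T τ (hu2.toLp u) =ᵐ[volOn 0 T] fun t => ∫ s in (0 : ℝ)..(t - τ), u s := by
  obtain ⟨C, hC⟩ := hs.exists_bound_of_continuous hu
  let B : ℝ → (ℝ →ᵇ E) := fun r => BoundedContinuousFunction.ofNormedAddCommGroup
      (fun t => u (t - r)) (by fun_prop) C (fun t => hC _)
  have hB : Continuous B := continuous_bcf_translate hu hs hC
  have hψ : (hu2.toLp u : ℝ → E) =ᵐ[volume] u := hu2.coeFn_toLp
  have e1 (r : ℝ) : shiftRestrict T r (hu2.toLp u) = bcfToL2 0 T (B r) := by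
    refine Lp.ext ?_
    have h1 := coeFn_shiftRestrict T r (hu2.toLp u)
    have h2 := coeFn_bcfToL2 (a := 0) (c := T) (B r)
    have h3 : ∀ᵐ t ∂(volOn 0 T), (hu2.toLp u : ℝ → E) (t - r) = u (t - r) :=
      ae_restrict_of_ae ((measurePreserving_sub_right volume r).quasiMeasurePreserving.ae hψ)
    filter_upwards [h1, h2, h3] with t h1 h2 h3
    rw [h1, h2, h3]
    rfl
  have e2 : shiftIntegral T τ (hu2.toLp u) = bcfToL2 0 T (∫ r in (0 : ℝ)..τ, B r) := by
    rw [shiftIntegral_apply]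
    simp only [e1]
    exact (bcfToL2 0 T).intervalIntegral_comp_comm (hB.intervalIntegrable (μ := volume) 0 τ)
  have e3 (t : ℝ) : (∫ r in (0 : ℝ)..τ, B r) t = ∫ s in (t - τ)..t, u s := by
    have h := (BoundedContinuousFunction.evalCLM ℝ t).intervalIntegral_comp_comm
      (hB.intervalIntegrable (μ := volume) 0 τ)
    change _ = (∫ r in (0 : ℝ)..τ, B r) t at h
    rw [← h]
    change ∫ r in (0 : ℝ)..τ, u (t - r) = _
    rw [intervalIntegral.integral_comp_sub_left, sub_zero]
  rw [delayPrimitive_apply, e2, ← map_sub]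
  have h1 := coeFn_bcfToL2 (a := 0) (c := T)
    (primitive 0 T (restrictL2 0 T (hu2.toLp u)) - ∫ r in (0 : ℝ)..τ, B r)
  filter_upwards [h1, ae_restrict_mem measurableSet_Ioo] with t h1 ht
  rw [h1, BoundedContinuousFunction.sub_apply, e3, primitive_restrictL2 _ (Ioo_subset_Icc_self ht),
    intervalIntegral.integral_congr_ae (g := u) (by filter_upwards [hψ] with s hs _ using hs)]
  rw [sub_eq_iff_eq_add, intervalIntegral.integral_add_adjacent_intervals
    (hu.intervalIntegrable _ _) (hu.intervalIntegrable _ _)]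

theorem dense_continuous_compactSupport :
    Dense {ψ : Lp E 2 (volume : Measure ℝ) | ∃ (u : ℝ → E) (_ : Continuous u)
      (_ : HasCompactSupport u) (h : MemLp u 2 volume), ψ = h.toLp u} := by
  rw [Metric.dense_iff]
  intro ψ ε hε
  obtain ⟨u, hs, hle, hu, hm⟩ := (Lp.memLp ψ).exists_hasCompactSupport_eLpNorm_sub_le
    (by norm_num) (ε := ENNReal.ofReal (ε / 2)) (by simpa using hε)
  refine ⟨hm.toLp u, ?_, u, hu, hs, hm, rfl⟩
  rw [Metric.mem_ball, dist_comm, dist_eq_norm]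
  refine lt_of_le_of_lt ?_ (half_lt_self hε)
  have e : ψ - hm.toLp u = ((Lp.memLp ψ).sub hm).toLp _ := by
    rw [MemLp.toLp_sub (Lp.memLp ψ) hm, Lp.toLp_coeFn]
  rw [e, Lp.norm_toLp]
  exact ENNReal.toReal_le_of_le_ofReal (half_pos hε).le hle

/-- By density of continuous compactly supported functions: the left side converges in `L²`, hence
a.e. along a subsequence, and the right side converges for every `t`. -/
theorem coeFn_delayPrimitive [CompleteSpace E] (T τ : ℝ) (ψ : Lp E 2 (volume : Measure ℝ)) :
    delayPrimitive T τ ψ =ᵐ[volOn 0 T] fun t => ∫ s in (0 : ℝ)..(t - τ), ψ s := by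
  obtain ⟨χ, hχ, hlim⟩ := mem_closure_iff_seq_limit.1 (dense_continuous_compactSupport ψ)
  have hχ' (k : ℕ) : delayPrimitive T τ (χ k) =ᵐ[volOn 0 T]
      fun t => ∫ s in (0 : ℝ)..(t - τ), χ k s := by
    obtain ⟨u, hu, hs, hm, e⟩ := hχ k
    rw [e]
    filter_upwards [coeFn_delayPrimitive_of_continuous T τ hu hs hm] with t ht
    rw [ht]
    refine intervalIntegral.integral_congr_ae ?_
    filter_upwards [hm.coeFn_toLp] with s hs _
    exact hs.symm
  have h1 := ((delayPrimitive T τ).continuous.tendsto ψ).comp hlim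
  obtain ⟨ns, hns, hae⟩ := (tendstoInMeasure_of_tendsto_Lp h1).exists_seq_tendsto_ae
  filter_upwards [hae, ae_all_iff.2 hχ'] with t h2 h3
  refine tendsto_nhds_unique h2 ?_
  have h4 := (tendsto_intervalIntegral_of_tendsto_L2 hlim 0 (t - τ)).comp hns.tendsto_atTop
  refine h4.congr fun k => ?_
  exact (h3 (ns k)).symm

end DelayPrimitive

/-! ### Retarded Volterra equations -/

section Volterra

variable {E : Type*} [NormedAddCommGroup E] [NormedSpace ℝ E]

theorem integral_exp_mul_le {K : ℝ} (hK : 0 < K) (t : ℝ) :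
    ∫ s in (0 : ℝ)..t, Real.exp (K * s) ≤ Real.exp (K * t) / K := by
  have h (s : ℝ) : HasDerivAt (fun s => Real.exp (K * s) / K) (Real.exp (K * s)) s := by
    have := (((hasDerivAt_id s).const_mul K).exp).div_const K
    simpa [hK.ne'] using this
  rw [intervalIntegral.integral_eq_sub_of_hasDerivAt (fun s _ => h s)
    ((by fun_prop : Continuous fun s => Real.exp (K * s)).intervalIntegrable _ _)]
  simp only [mul_zero, Real.exp_zero]
  have : 0 < 1 / K := by positivity
  linarith

/-- Integrating `exp (K s)` gains a factor `1 / K`, and `2 C / K ≤ 1 / 2`. The 2 in the hypothesis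
accounts for the present and the delayed argument. -/
theorem norm_primitive_le_of_exp {T C D K t : ℝ} (hD : 0 ≤ D) (hK : 0 < K) (hCK : 4 * C ≤ K)
    (v : Lp E 2 (volOn 0 T))
    (hv : ∀ᵐ s ∂(volOn 0 T), ‖v s‖ ≤ 2 * C * D * Real.exp (K * s)) (ht : t ∈ Icc 0 T) :
    ‖primitive 0 T v t‖ ≤ D / 2 * Real.exp (K * t) := by
  have hc : Continuous fun s => 2 * C * D * Real.exp (K * s) := by fun_prop
  rw [primitive_apply]
  refine (intervalIntegral.norm_integral_le_of_norm_le ht.1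
    (by filter_upwards [hv] with s hs _ using hs) ?_).trans ?_
  · have h : IntegrableOn (fun s => 2 * C * D * Real.exp (K * s)) (Ioo 0 T) :=
      hc.integrableOn_Icc.mono_set Ioo_subset_Icc_self
    exact Integrable.intervalIntegrable h
  rw [intervalIntegral_volOn_of_mem (left_mem_Icc.2 (ht.1.trans ht.2)) ht,
    intervalIntegral.integral_const_mul]
  have h1 := integral_exp_mul_le hK t
  have h0 : 0 ≤ ∫ s in (0 : ℝ)..t, Real.exp (K * s) :=
    intervalIntegral.integral_nonneg ht.1 fun _ _ => (Real.exp_pos _).le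
  calc 2 * C * D * ∫ s in (0 : ℝ)..t, Real.exp (K * s)
      ≤ K / 2 * D * ∫ s in (0 : ℝ)..t, Real.exp (K * s) := by gcongr; linarith
    _ ≤ K / 2 * D * (Real.exp (K * t) / K) := by gcongr
    _ = D / 2 * Real.exp (K * t) := by field_simp

theorem norm_primitive_le_of_Icc {T B : ℝ} (hT : 0 ≤ T) (v : Lp E 2 (volOn 0 T))
    (h : ∀ t ∈ Icc 0 T, ‖primitive 0 T v t‖ ≤ B) : ‖primitive 0 T v‖ ≤ B := by
  have hB : 0 ≤ B := (norm_nonneg _).trans (h 0 ⟨le_rfl, hT⟩)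
  refine (BoundedContinuousFunction.norm_le hB).2 fun t => ?_
  rcases le_total t 0 with h0 | h0
  · rwa [primitive_zero_left v h0, norm_zero]
  rcases le_total t T with h1 | h1
  · exact h t ⟨h0, h1⟩
  · rw [primitive_of_ge v h1]
    exact h T ⟨hT, le_rfl⟩

/-- A Volterra equation with a (retarded) Lipschitz right-hand side has exactly one solution. -/
theorem existsUnique_primitive_eq [CompleteSpace E] {T C τ : ℝ} (hT : 0 ≤ T) (hC : 0 ≤ C)
    (hτ : 0 ≤ τ) (N : (ℝ →ᵇ E) → Lp E 2 (volOn 0 T))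
    (hN : ∀ u w : ℝ →ᵇ E, ∀ᵐ s ∂(volOn 0 T), ‖N u s - N w s‖ ≤
      C * (‖u s - w s‖ + ‖u (max (s - τ) 0) - w (max (s - τ) 0)‖)) :
    ∃! u : ℝ →ᵇ E, primitive 0 T (N u) = u := by
  set Φ : (ℝ →ᵇ E) → (ℝ →ᵇ E) := fun u => primitive 0 T (N u) with hΦ
  set K : ℝ := 4 * C + 1 with hK
  have hKpos : 0 < K := by positivity
  -- In the norm weighted by `exp (-K s)` one application of `Φ` halves distances; the delayed time
  -- `max (r - τ) 0` is at most `r`, so its weight is no worse.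
  have step (u w : ℝ →ᵇ E) (D : ℝ) (hD : 0 ≤ D)
      (h : ∀ s ∈ Icc 0 T, ‖u s - w s‖ ≤ D * Real.exp (K * s)) :
      ∀ s ∈ Icc 0 T, ‖primitive 0 T (N u - N w) s‖ ≤ D / 2 * Real.exp (K * s) := by
    intro s hs
    refine norm_primitive_le_of_exp hD hKpos (C := C) (by rw [hK]; linarith) _ ?_ hs
    filter_upwards [hN u w, Lp.coeFn_sub (N u) (N w), ae_restrict_mem measurableSet_Ioo]
      with r h1 h2 hr
    rw [h2, Pi.sub_apply]
    have h3 := h r (Ioo_subset_Icc_self hr)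
    have h4 := h (max (r - τ) 0) ⟨le_max_right _ _, max_le (by linarith [hr.2]) hT⟩
    have h5 : Real.exp (K * max (r - τ) 0) ≤ Real.exp (K * r) := by
      have : max (r - τ) 0 ≤ r := max_le (by linarith) hr.1.le
      gcongr
    have h6 : D * Real.exp (K * max (r - τ) 0) ≤ D * Real.exp (K * r) := by gcongr
    calc ‖N u r - N w r‖ ≤ C * (D * Real.exp (K * r) + D * Real.exp (K * r)) :=
          h1.trans (by gcongr; exact h4.trans h6)
      _ = _ := by ring
  have iter (k : ℕ) (u w : ℝ →ᵇ E) : ∀ s ∈ Icc 0 T,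
      ‖Φ^[k] u s - Φ^[k] w s‖ ≤ ‖u - w‖ * (1 / 2) ^ k * Real.exp (K * s) := by
    induction k with
    | zero =>
      intro s hs
      have h1 : (1 : ℝ) ≤ Real.exp (K * s) := Real.one_le_exp (mul_nonneg hKpos.le hs.1)
      have h2 := (u - w).norm_coe_le_norm s
      simpa using h2.trans (le_mul_of_one_le_right (norm_nonneg (u - w)) h1)
    | succ k ih =>
      intro s hs
      rw [Function.iterate_succ_apply', Function.iterate_succ_apply']
      have h := step _ _ _ (by positivity) ih s hs
      rw [map_sub] at h
      refine h.trans (le_of_eq ?_)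
      ring
  -- With this many halvings the weight `exp (K T)` is absorbed, and `Φ^[k + 1]` contracts in the
  -- unweighted sup norm.
  obtain ⟨k, hk⟩ := exists_pow_lt_of_lt_one (x := (2 * Real.exp (K * T))⁻¹) (by positivity)
    (show (1 / 2 : ℝ) < 1 by norm_num)
  have hlip (u w : ℝ →ᵇ E) : dist (Φ^[k + 1] u) (Φ^[k + 1] w) ≤ (1 / 2 : NNReal) * dist u w := by
    rw [dist_eq_norm, dist_eq_norm, Function.iterate_succ_apply', Function.iterate_succ_apply',
      hΦ, ← map_sub]
    refine norm_primitive_le_of_Icc hT _ fun s hs => ?_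
    refine (step _ _ _ (by positivity) (iter k u w) s hs).trans ?_
    have h1 : Real.exp (K * s) ≤ Real.exp (K * T) := by
      have := hs.2
      gcongr
    have h2 : (1 / 2 : ℝ) ^ k * Real.exp (K * T) ≤ 1 / 2 := by
      calc (1 / 2 : ℝ) ^ k * Real.exp (K * T)
          ≤ (2 * Real.exp (K * T))⁻¹ * Real.exp (K * T) := by gcongr
        _ = 1 / 2 := by field_simp
    calc ‖u - w‖ * (1 / 2) ^ k / 2 * Real.exp (K * s)
        ≤ ‖u - w‖ * (1 / 2) ^ k / 2 * Real.exp (K * T) := by gcongr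
      _ = ‖u - w‖ / 2 * ((1 / 2) ^ k * Real.exp (K * T)) := by ring
      _ ≤ ‖u - w‖ / 2 * (1 / 2) := by gcongr
      _ ≤ _ := by
        have := norm_nonneg (u - w)
        push_cast
        linarith
  have hcontr : ContractingWith (1 / 2) (Φ^[k + 1]) :=
    ⟨by rw [← NNReal.coe_lt_coe]; norm_num, LipschitzWith.of_dist_le_mul hlip⟩
  refine ⟨_, hcontr.isFixedPt_fixedPoint_iterate, fun w hw => ?_⟩
  exact hcontr.fixedPoint_unique (Function.IsFixedPt.iterate (f := Φ) hw _)

/-- Fixed points of `N ∘ primitive` and of `primitive ∘ N` correspond to each other through `N` and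
`primitive`. -/
theorem existsUnique_eq_comp_primitive [CompleteSpace E] {T C τ : ℝ} (hT : 0 ≤ T) (hC : 0 ≤ C)
    (hτ : 0 ≤ τ) (N : (ℝ →ᵇ E) → Lp E 2 (volOn 0 T))
    (hN : ∀ u w : ℝ →ᵇ E, ∀ᵐ s ∂(volOn 0 T), ‖N u s - N w s‖ ≤
      C * (‖u s - w s‖ + ‖u (max (s - τ) 0) - w (max (s - τ) 0)‖)) :
    ∃! v : Lp E 2 (volOn 0 T), N (primitive 0 T v) = v := by
  obtain ⟨u, hu, huniq⟩ := existsUnique_primitive_eq hT hC hτ N hN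
  refine ⟨N u, congrArg N hu, fun w hw => ?_⟩
  rw [← huniq (primitive 0 T w) (congrArg (primitive 0 T) hw), hw]

end Volterra

/-! ### Superposition operators on bounded continuous functions -/

section Superposition

variable {E F : Type*} [NormedAddCommGroup E] [NormedAddCommGroup F]

/-- The superposition operator `u ↦ h ∘ u` for a compactly supported continuous function `h`. -/
def superposition (h : E → F) (hc : Continuous h) (hs : HasCompactSupport h) (u : ℝ →ᵇ E) :
    ℝ →ᵇ F :=
  BoundedContinuousFunction.ofNormedAddCommGroup (fun t => h (u t)) (hc.comp u.continuous)
    (hs.exists_bound_of_continuous hc).choose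
    (fun _ => (hs.exists_bound_of_continuous hc).choose_spec _)

theorem superposition_apply (h : E → F) (hc : Continuous h) (hs : HasCompactSupport h)
    (u : ℝ →ᵇ E) (t : ℝ) : superposition h hc hs u t = h (u t) := rfl

theorem uniformContinuous_superposition (h : E → F) (hc : Continuous h)
    (hs : HasCompactSupport h) : UniformContinuous (superposition h hc hs) := by
  rw [Metric.uniformContinuous_iff]
  intro ε hε
  obtain ⟨δ, hδ, H⟩ := Metric.uniformContinuous_iff.1 (hs.uniformContinuous_of_continuous hc)
    (ε / 2) (half_pos hε)
  refine ⟨δ, hδ, fun {u w} huw => lt_of_le_of_lt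
    ((BoundedContinuousFunction.dist_le (half_pos hε).le).2 fun t => ?_) (half_lt_self hε)⟩
  exact (H ((BoundedContinuousFunction.dist_coe_le_dist t).trans_lt huw)).le

variable [NormedSpace ℝ E] [NormedSpace ℝ F]

theorem norm_apply_apply_le (D : ℝ →ᵇ (E →L[ℝ] F)) (u : ℝ →ᵇ E) (t : ℝ) :
    ‖D t (u t)‖ ≤ ‖D‖ * ‖u‖ := by
  refine ((D t).le_opNorm _).trans ?_
  gcongr
  · exact D.norm_coe_le_norm t
  · exact u.norm_coe_le_norm t

/-- Pointwise application of a bounded continuous family of operators, as an operator on bounded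
continuous functions. -/
def pointwiseApply : (ℝ →ᵇ (E →L[ℝ] F)) →L[ℝ] (ℝ →ᵇ E) →L[ℝ] (ℝ →ᵇ F) :=
  LinearMap.mkContinuous₂
    (LinearMap.mk₂ ℝ
      (fun (D : ℝ →ᵇ (E →L[ℝ] F)) (u : ℝ →ᵇ E) => BoundedContinuousFunction.ofNormedAddCommGroup (fun t => D t (u t))
        (D.continuous.clm_apply u.continuous) (‖D‖ * ‖u‖)
        (norm_apply_apply_le D u))
      (fun _ _ _ => rfl) (fun _ _ _ => rfl)
      (fun D u w => by ext t; exact map_add (D t) _ _)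
      (fun c D u => by ext t; exact map_smul (D t) c _))
    1 (fun D u => by
      rw [one_mul]
      exact (BoundedContinuousFunction.norm_le (by positivity)).2 (norm_apply_apply_le D u))

/-- The mean value inequality, with an error uniform in `t` because the compactly supported
derivative is uniformly continuous. The sup norm is essential: on `L²` such operators are in general
not Fréchet differentiable. -/
theorem hasFDerivAt_superposition {h : E → F} (hd : ContDiff ℝ 1 h) (hs : HasCompactSupport h)
    (u : ℝ →ᵇ E) :
    HasFDerivAt (superposition h hd.continuous hs)
      (pointwiseApply (superposition (fderiv ℝ h) (hd.continuous_fderiv one_ne_zero)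
        (hs.fderiv ℝ) u)) u := by
  rw [hasFDerivAt_iff_isLittleO_nhds_zero, Asymptotics.isLittleO_iff]
  intro ε hε
  obtain ⟨δ, hδ, H⟩ := Metric.uniformContinuous_iff.1
    ((hs.fderiv ℝ).uniformContinuous_of_continuous (hd.continuous_fderiv one_ne_zero)) ε hε
  filter_upwards [Metric.ball_mem_nhds 0 hδ] with k hk
  rw [mem_ball_zero_iff] at hk
  refine (BoundedContinuousFunction.norm_le (by positivity)).2 fun t => ?_
  change ‖h (u t + k t) - h (u t) - fderiv ℝ h (u t) (k t)‖ ≤ _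
  have hkt : ‖k t‖ ≤ ‖k‖ := k.norm_coe_le_norm t
  have := Convex.norm_image_sub_le_of_norm_hasFDerivWithin_le'
    (f := h) (f' := fderiv ℝ h) (φ := fderiv ℝ h (u t)) (C := ε) (s := Metric.ball (u t) δ)
    (x := u t) (y := u t + k t)
    (fun x _ => (hd.differentiable one_ne_zero x).hasFDerivAt.hasFDerivWithinAt)
    (fun x hx => by rw [← dist_eq_norm]; exact (H hx).le) (convex_ball _ _)
    (Metric.mem_ball_self hδ) (by rw [Metric.mem_ball, dist_eq_norm]; simpa using hkt.trans_lt hk)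
  rw [add_sub_cancel_left] at this
  exact this.trans (by gcongr)

theorem contDiff_superposition {h : E → F} (hd : ContDiff ℝ 1 h) (hs : HasCompactSupport h) :
    ContDiff ℝ 1 (superposition h hd.continuous hs) := by
  rw [contDiff_one_iff_hasFDerivAt]
  refine ⟨_, ?_, hasFDerivAt_superposition hd hs⟩
  exact pointwiseApply.continuous.comp (uniformContinuous_superposition _ _ _).continuous

end Superposition

/-! ### The delay equation in `L²` and the implicit function theorem -/

section DelayEquation

variable {E : Type*} [NormedAddCommGroup E]

/-- The function `t ↦ u((t - τ)⁺)`. -/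
def delayPos (τ : ℝ) (u : ℝ →ᵇ E) : ℝ →ᵇ E :=
  u.compContinuous ⟨fun t => max (t - τ) 0, by fun_prop⟩

theorem delayPos_apply (τ : ℝ) (u : ℝ →ᵇ E) (t : ℝ) : delayPos τ u t = u (max (t - τ) 0) := rfl

variable [NormedSpace ℝ E]

/-- The common form of the nonlinear equation and of its linearization. -/
theorem existsUnique_add_bcf_eq [CompleteSpace E] {T C τ : ℝ} (hT : 0 ≤ T) (hC : 0 ≤ C)
    (hτ : 0 ≤ τ) (r : Lp E 2 (volOn 0 T)) (B : (ℝ →ᵇ E) → (ℝ →ᵇ E))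
    (hB : ∀ (u w : ℝ →ᵇ E) (s : ℝ), ‖B u s - B w s‖ ≤
      C * (‖u s - w s‖ + ‖u (max (s - τ) 0) - w (max (s - τ) 0)‖)) :
    ∃! v : Lp E 2 (volOn 0 T), r + bcfToL2 0 T (B (primitive 0 T v)) = v := by
  refine existsUnique_eq_comp_primitive hT hC hτ (fun u => r + bcfToL2 0 T (B u)) fun u w => ?_
  filter_upwards [Lp.coeFn_add r (bcfToL2 0 T (B u)), Lp.coeFn_add r (bcfToL2 0 T (B w)),
    coeFn_bcfToL2 (a := 0) (c := T) (B u), coeFn_bcfToL2 (a := 0) (c := T) (B w)]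
    with s h1 h2 h3 h4
  rw [h1, h2, Pi.add_apply, Pi.add_apply, h3, h4, add_sub_add_left_eq_sub]
  exact hB u w s

/-- The primitive of a function extended by zero vanishes at negative times, so truncating `t - τ`
at zero changes nothing. This gives the delay term the form required by the Volterra lemma. -/
theorem delayPrimitive_extendZero [CompleteSpace E] (T τ : ℝ) (v : Lp E 2 (volOn 0 T)) :
    delayPrimitive T τ (extendZero 0 T v) = bcfToL2 0 T (delayPos τ (primitive 0 T v)) := by
  refine Lp.ext ?_
  have h1 := coeFn_delayPrimitive T τ (extendZero 0 T v)
  have h2 := coeFn_bcfToL2 (a := 0) (c := T) (delayPos τ (primitive 0 T v))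
  filter_upwards [h1, h2] with t h1 h2
  rw [h1, h2, ← primitive_eq_extendZero, delayPos_apply]
  rcases le_total (t - τ) 0 with h | h
  · rw [max_eq_right h, primitive_zero_left v h, primitive_zero_left v le_rfl]
  · rw [max_eq_left h]

/-- The action of a bounded operator on `L²(0, T)`. -/
abbrev mapL2 (T : ℝ) (A : E →L[ℝ] E) : Lp E 2 (volOn 0 T) →L[ℝ] Lp E 2 (volOn 0 T) :=
  A.compLpL 2 (volOn 0 T)

theorem mapL2_bcfToL2 (T : ℝ) (A : E →L[ℝ] E) (u : ℝ →ᵇ E) :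
    mapL2 T A (bcfToL2 0 T u) = bcfToL2 0 T (A.compLeftContinuousBounded ℝ u) := by
  refine Lp.ext ?_
  filter_upwards [A.coeFn_compLpL (bcfToL2 0 T u), coeFn_bcfToL2 (a := 0) (c := T) u,
    coeFn_bcfToL2 (a := 0) (c := T) (A.compLeftContinuousBounded ℝ u)] with t h1 h2 h3
  rw [h1, h2, h3]
  rfl

/-- The residual of the delay equation `v + h(∫₀ᵗ v) = A ∫₀^{t - τ} (p + v) + G` in `L²(0, T)`. -/
def delayResidual (T : ℝ) {h : E → E} (hd : ContDiff ℝ 1 h) (hs : HasCompactSupport h) (A : E →L[ℝ] E)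
    (p : Lp E 2 (volume : Measure ℝ)) (G : Lp E 2 (volOn 0 T)) (q : ℝ × Lp E 2 (volOn 0 T)) :
    Lp E 2 (volOn 0 T) :=
  q.2 + bcfToL2 0 T (superposition h hd.continuous hs (primitive 0 T q.2)) -
    mapL2 T A (delayPrimitive T q.1 (p + extendZero 0 T q.2)) - G

/-- The linearization of `delayResidual` in its second argument. -/
def linearizedResidual (T : ℝ) (D : ℝ →ᵇ (E →L[ℝ] E)) (A : E →L[ℝ] E) (τ : ℝ) :
    Lp E 2 (volOn 0 T) →L[ℝ] Lp E 2 (volOn 0 T) :=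
  ContinuousLinearMap.id ℝ _ +
    (bcfToL2 0 T).comp ((pointwiseApply D).comp (primitive 0 T)) -
    (mapL2 T A).comp ((delayPrimitive T τ).comp (extendZero 0 T).toContinuousLinearMap)

theorem linearizedResidual_apply (T : ℝ) (D : ℝ →ᵇ (E →L[ℝ] E)) (A : E →L[ℝ] E) (τ : ℝ)
    (w : Lp E 2 (volOn 0 T)) :
    linearizedResidual T D A τ w = w + bcfToL2 0 T (pointwiseApply D (primitive 0 T w)) -
      mapL2 T A (delayPrimitive T τ (extendZero 0 T w)) := rfl

theorem norm_clm_sub_sub_le (A : E →L[ℝ] E) {C : ℝ} {a b x y : E} {k : ℝ} (ha : ‖a - b‖ ≤ C * k) :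
    ‖(A x - a) - (A y - b)‖ ≤ C * k + ‖A‖ * ‖x - y‖ := by
  rw [show A x - a - (A y - b) = A (x - y) - (a - b) by rw [map_sub]; abel, add_comm]
  exact (norm_sub_le _ _).trans (add_le_add (A.le_opNorm _) ha)

/-- Inverting it means solving a linear Volterra equation with delay, whose Lipschitz constant comes
from `‖D‖` for the present state and `‖A‖` for the delayed one. -/
theorem bijective_linearizedResidual [CompleteSpace E] {T τ : ℝ} (hT : 0 ≤ T) (hτ : 0 ≤ τ)
    (D : ℝ →ᵇ (E →L[ℝ] E)) (A : E →L[ℝ] E) :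
    Function.Bijective (linearizedResidual T D A τ) := by
  rw [Function.bijective_iff_existsUnique]
  intro r
  have key := existsUnique_add_bcf_eq (C := max ‖D‖ ‖A‖) hT
    (le_max_of_le_right (norm_nonneg A)) hτ r
    (fun u => A.compLeftContinuousBounded ℝ (delayPos τ u) - pointwiseApply D u) (by
      intro u w s
      refine (norm_clm_sub_sub_le A (C := ‖D‖) (k := ‖u s - w s‖) (a := D s (u s))
        (b := D s (w s)) ?_).trans ?_
      · rw [← map_sub]
        exact ((D s).le_opNorm _).trans (by gcongr; exact D.norm_coe_le_norm s)
      · rw [mul_add]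
        gcongr
        · exact le_max_left _ _
        · exact le_max_right _ _
        · rfl)
  refine (existsUnique_congr fun w => ?_).1 key
  rw [linearizedResidual_apply, delayPrimitive_extendZero, mapL2_bcfToL2, map_sub]
  constructor
  · intro h
    nth_rewrite 1 [← h]
    abel
  · intro h
    rw [← h]
    abel

/-- The same Volterra argument; compact support makes `h` globally Lipschitz. -/
theorem existsUnique_residual_eq_zero [CompleteSpace E] {T τ : ℝ} (hT : 0 ≤ T) (hτ : 0 ≤ τ)
    {h : E → E} (hd : ContDiff ℝ 1 h) (hs : HasCompactSupport h) (A : E →L[ℝ] E)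
    (p : Lp E 2 (volume : Measure ℝ)) (G : Lp E 2 (volOn 0 T)) :
    ∃! v, delayResidual T hd hs A p G (τ, v) = 0 := by
  obtain ⟨K, hK⟩ := ContDiff.lipschitzWith_of_hasCompactSupport hs hd one_ne_zero
  have key := existsUnique_add_bcf_eq (C := max (K : ℝ) ‖A‖) hT
    (le_max_of_le_right (norm_nonneg A)) hτ (G + mapL2 T A (delayPrimitive T τ p))
    (fun u => A.compLeftContinuousBounded ℝ (delayPos τ u) -
      superposition h hd.continuous hs u) (by
      intro u w s
      refine (norm_clm_sub_sub_le A (C := K) (k := ‖u s - w s‖) (a := h (u s))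
        (b := h (w s)) ?_).trans ?_
      · exact hK.norm_sub_le _ _
      · rw [mul_add]
        gcongr
        · exact le_max_left _ _
        · exact le_max_right _ _
        · rfl)
  refine (existsUnique_congr fun w => ?_).1 key
  rw [delayResidual]
  dsimp only
  rw [map_add, delayPrimitive_extendZero, map_add, mapL2_bcfToL2, map_sub, sub_sub, sub_eq_zero]
  constructor
  · intro h
    nth_rewrite 1 [← h]
    abel
  · intro h
    rw [eq_comm, ← sub_eq_zero] at h ⊢
    rw [← neg_eq_zero, ← h]
    abel

theorem contDiff_residual [CompleteSpace E] (T : ℝ) {h : E → E} (hd : ContDiff ℝ 1 h)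
    (hs : HasCompactSupport h) (A : E →L[ℝ] E) (p : Lp E 2 (volume : Measure ℝ))
    (G : Lp E 2 (volOn 0 T)) : ContDiff ℝ 1 (delayResidual T hd hs A p G) := by
  have hsnd : ContDiff ℝ 1 (Prod.snd : ℝ × Lp E 2 (volOn 0 T) → Lp E 2 (volOn 0 T)) := contDiff_snd
  have hI := ((primitive (E := E) 0 T).contDiff (n := 1)).comp hsnd
  have h1 := ((bcfToL2 (E := E) 0 T).contDiff (n := 1)).comp ((contDiff_superposition hd hs).comp hI)
  have hX := ((extendZero (E := E) 0 T).contDiff (n := 1)).comp hsnd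
  have h2 := (contDiff_fst (𝕜 := ℝ) (n := 1) (E := ℝ) (F := Lp E 2 (volOn 0 T))).prodMk
    ((contDiff_const (c := p)).add hX)
  have h3 := ((mapL2 T A).contDiff (n := 1)).comp ((contDiff_delayPrimitive T).comp h2)
  have h4 := ((hsnd.add h1).sub h3).sub (contDiff_const (c := G))
  exact h4

theorem hasFDerivAt_residual_right (T : ℝ) {h : E → E} (hd : ContDiff ℝ 1 h)
    (hs : HasCompactSupport h) (A : E →L[ℝ] E) (p : Lp E 2 (volume : Measure ℝ))
    (G : Lp E 2 (volOn 0 T)) (τ : ℝ) (v : Lp E 2 (volOn 0 T)) :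
    HasFDerivAt (fun w => delayResidual T hd hs A p G (τ, w))
      (linearizedResidual T (superposition (fderiv ℝ h) (hd.continuous_fderiv one_ne_zero)
        (hs.fderiv ℝ) (primitive 0 T v)) A τ) v := by
  have h1 : HasFDerivAt (fun w : Lp E 2 (volOn 0 T) =>
      bcfToL2 0 T (superposition h hd.continuous hs (primitive 0 T w))) _ v :=
    (bcfToL2 0 T).hasFDerivAt.comp v
      ((hasFDerivAt_superposition hd hs _).comp v (primitive 0 T).hasFDerivAt)
  have h2 : HasFDerivAt (fun w : Lp E 2 (volOn 0 T) => p + extendZero 0 T w) _ v :=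
    (extendZero 0 T).toContinuousLinearMap.hasFDerivAt.const_add p
  have h3 : HasFDerivAt (fun w : Lp E 2 (volOn 0 T) =>
      mapL2 T A (delayPrimitive T τ (p + extendZero 0 T w))) _ v :=
    (mapL2 T A).hasFDerivAt.comp v ((delayPrimitive T τ).hasFDerivAt.comp v h2)
  exact (((hasFDerivAt_id v).add h1).sub h3).sub_const G

/-- The zeros of `delayResidual` depend continuously differentiably on the delay. -/
theorem contDiffOn_of_residual_eq_zero [CompleteSpace E] {T b : ℝ} (hT : 0 ≤ T) {h : E → E}
    (hd : ContDiff ℝ 1 h) (hs : HasCompactSupport h) (A : E →L[ℝ] E)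
    (p : Lp E 2 (volume : Measure ℝ)) (G : Lp E 2 (volOn 0 T)) (v : ℝ → Lp E 2 (volOn 0 T))
    (hv : ∀ τ ∈ Icc 0 b, delayResidual T hd hs A p G (τ, v τ) = 0) :
    ContDiffOn ℝ 1 v (Icc 0 b) := by
  intro τ hτ
  have hc : ContDiffAt ℝ 1 (delayResidual T hd hs A p G) (τ, v τ) :=
    (contDiff_residual T hd hs A p G).contDiffAt
  set D := superposition (fderiv ℝ h) (hd.continuous_fderiv one_ne_zero) (hs.fderiv ℝ)
    (primitive 0 T (v τ)) with hD
  -- The partial derivative in `v` is identified through uniqueness of the Fréchet derivative.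
  have he : fderiv ℝ (delayResidual T hd hs A p G) (τ, v τ) ∘L
      ContinuousLinearMap.inr ℝ ℝ (Lp E 2 (volOn 0 T)) = linearizedResidual T D A τ :=
    ((hc.differentiableAt one_ne_zero).hasFDerivAt.comp (v τ)
      (hasFDerivAt_prodMk_right τ (v τ))).unique (hasFDerivAt_residual_right T hd hs A p G τ (v τ))
  have hinv : (fderiv ℝ (delayResidual T hd hs A p G) (τ, v τ) ∘L
      ContinuousLinearMap.inr ℝ ℝ (Lp E 2 (volOn 0 T))).IsInvertible := by
    have hb := bijective_linearizedResidual hT hτ.1 D A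
    rw [he]
    -- Boundedness of the inverse is the open mapping theorem.
    exact ⟨ContinuousLinearEquiv.ofBijective _ (LinearMap.ker_eq_bot.2 hb.1)
      (LinearMap.range_eq_top.2 hb.2), ContinuousLinearEquiv.coe_ofBijective _ _ _⟩
  have hψ := hc.contDiffAt_implicitFunction one_ne_zero hinv
  have hz := hc.eventually_apply_implicitFunction one_ne_zero hinv
  -- The residual makes sense for all real `τ`, so the implicit function lives on a full
  -- neighbourhood even at the end points; uniqueness of zeros equates it with `v` inside `[0, b]`.
  refine hψ.contDiffWithinAt.congr_of_eventuallyEq ?_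
    (hc.implicitFunction_apply_self one_ne_zero hinv).symm
  filter_upwards [nhdsWithin_le_nhds hz, self_mem_nhdsWithin] with σ h1 hσ
  exact (existsUnique_residual_eq_zero hT hσ.1 hd hs A p G).unique (hv σ hσ) (h1.trans (hv τ hτ))

end DelayEquation

/-! ### Product and chain rules for absolutely continuous functions -/

section IntegrationByParts

theorem absolutelyContinuousOnInterval_const_add_primitive {f : ℝ → ℝ} {a b : ℝ}
    (hf : IntervalIntegrable f volume a b) (α : ℝ) :
    AbsolutelyContinuousOnInterval (fun x => α + ∫ s in a..x, f s) a b := by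
  have h := (contDiff_const (c := α) (𝕜 := ℝ) (n := 1) (E := ℝ)).contDiffOn
    (s := uIcc a b) |>.absolutelyContinuousOnInterval
  exact h.fun_add (hf.absolutelyContinuousOnInterval_intervalIntegral left_mem_uIcc)

theorem integral_mul_add_mul_primitive {f g : ℝ → ℝ} {a b : ℝ}
    (hf : IntervalIntegrable f volume a b) (hg : IntervalIntegrable g volume a b) (α β : ℝ) :
    ∫ x in a..b, (f x * (β + ∫ s in a..x, g s) + (α + ∫ s in a..x, f s) * g x) =
      (α + ∫ s in a..b, f s) * (β + ∫ s in a..b, g s) - α * β := by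
  have h := (absolutelyContinuousOnInterval_const_add_primitive hf α).integral_deriv_mul_eq_sub
    (absolutelyContinuousOnInterval_const_add_primitive hg β)
  simp only [intervalIntegral.integral_same, add_zero] at h
  rw [← h]
  refine intervalIntegral.integral_congr_ae ?_
  filter_upwards [hf.ae_hasDerivAt_integral, hg.ae_hasDerivAt_integral] with x h1 h2 hx
  have hx' := uIoc_subset_uIcc hx
  rw [((h1 hx' a left_mem_uIcc).const_add α).deriv, ((h2 hx' a left_mem_uIcc).const_add β).deriv]

variable {n : ℕ}

theorem EuclideanSpace.intervalIntegral_apply {f : ℝ → Vec n} {a b : ℝ}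
    (hf : IntervalIntegrable f volume a b) (i : Fin n) :
    (∫ s in a..b, f s) i = ∫ s in a..b, f s i :=
  ((EuclideanSpace.proj (𝕜 := ℝ) i).intervalIntegral_comp_comm hf).symm

theorem EuclideanSpace.intervalIntegrable_apply {f : ℝ → Vec n} {a b : ℝ}
    (hf : IntervalIntegrable f volume a b) (i : Fin n) :
    IntervalIntegrable (fun s => f s i) volume a b :=
  ⟨(EuclideanSpace.proj (𝕜 := ℝ) i).integrable_comp hf.1,
    (EuclideanSpace.proj (𝕜 := ℝ) i).integrable_comp hf.2⟩

theorem IntervalIntegrable.continuousOn_const_add_primitive {w : ℝ → Vec n} {a b : ℝ}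
    (hw : IntervalIntegrable w volume a b) (k : Vec n) :
    ContinuousOn (fun t => k + ∫ s in a..t, w s) (uIcc a b) :=
  continuousOn_const.add (intervalIntegral.continuousOn_primitive_interval
    ((intervalIntegrable_iff' (by finiteness)).1 hw))

/-- The chain rule for the square of the norm of an absolutely continuous function. -/
theorem norm_sq_const_add_primitive {w : ℝ → Vec n} {a t : ℝ}
    (hw : IntervalIntegrable w volume a t) (k : Vec n) :
    ‖k + ∫ s in a..t, w s‖ ^ 2 =
      ‖k‖ ^ 2 + ∫ s in a..t, 2 * inner ℝ (k + ∫ r in a..s, w r) (w s) := by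
  have hwi := EuclideanSpace.intervalIntegrable_apply hw
  have hint (i : Fin n) : IntervalIntegrable
      (fun x => w x i * (k i + ∫ s in a..x, w s i) + (k i + ∫ s in a..x, w s i) * w x i)
      volume a t := by
    have hc := (absolutelyContinuousOnInterval_const_add_primitive (hwi i) (k i)).continuousOn
    exact ((hwi i).mul_continuousOn hc).add ((hwi i).continuousOn_mul hc)
  have e : ∫ s in a..t, 2 * inner ℝ (k + ∫ r in a..s, w r) (w s) =
      ∫ s in a..t, ∑ i, (w s i * (k i + ∫ r in a..s, w r i) +
        (k i + ∫ r in a..s, w r i) * w s i) := by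
    refine intervalIntegral.integral_congr fun s hs => ?_
    dsimp only
    rw [PiLp.inner_apply, Finset.mul_sum]
    refine Finset.sum_congr rfl fun i _ => ?_
    rw [PiLp.add_apply, EuclideanSpace.intervalIntegral_apply
      (hw.mono_set (uIcc_subset_uIcc left_mem_uIcc hs))]
    simp only [RCLike.inner_apply, conj_trivial]
    ring
  rw [e, intervalIntegral.integral_finsetSum fun i _ => hint i, EuclideanSpace.norm_sq_eq,
    EuclideanSpace.norm_sq_eq, ← Finset.sum_add_distrib]
  refine Finset.sum_congr rfl fun i _ => ?_
  rw [integral_mul_add_mul_primitive (hwi i) (hwi i), PiLp.add_apply,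
    EuclideanSpace.intervalIntegral_apply hw]
  simp only [Real.norm_eq_abs, sq_abs]
  ring

end IntegrationByParts

/-! ### Weak derivatives and primitives -/

section WeakDerivative

variable {n : ℕ}

theorem integral_volOn_eq {F : Type*} [NormedAddCommGroup F] [NormedSpace ℝ F] {a c : ℝ}
    (hac : a ≤ c) (f : ℝ → F) : ∫ t, f t ∂(volOn a c) = ∫ t in a..c, f t := by
  rw [intervalIntegral.integral_of_le hac, integral_Ioc_eq_integral_Ioo]

/-- A primitive of an integrable function has that function as weak derivative. -/
theorem hasWeakDeriv_const_add_primitive {a c : ℝ} (hac : a ≤ c) {w : ℝ → Vec n}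
    (hw : IntervalIntegrable w volume a c) (k : Vec n) :
    HasWeakDeriv a c (fun t => k + ∫ s in a..t, w s) w := by
  intro ψ hψ hs hsupp
  have hz (x : ℝ) (hx : x ∉ Ioo a c) : ψ x = 0 :=
    image_eq_zero_of_notMem_tsupport fun h => hx (hsupp h)
  have hψa := hz a (fun h => lt_irrefl _ h.1)
  have hψc := hz c (fun h => lt_irrefl _ h.2)
  have hψ' : Continuous (deriv ψ) := hψ.continuous_deriv (by simp)
  have hprim (x : ℝ) : ∫ s in a..x, deriv ψ s = ψ x := by
    rw [intervalIntegral.integral_deriv_eq_sub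
      (fun y _ => (hψ.differentiable (by simp)) y) (hψ'.intervalIntegrable _ _), hψa, sub_zero]
  have hi1 : IntervalIntegrable (fun t => deriv ψ t • (k + ∫ s in a..t, w s)) volume a c :=
    (hψ'.continuousOn.smul (hw.continuousOn_const_add_primitive k)).intervalIntegrable
  have hi2 : IntervalIntegrable (fun t => ψ t • w t) volume a c :=
    hw.continuousOn_smul hψ.continuous.continuousOn
  rw [integral_volOn_eq hac, integral_volOn_eq hac, ← add_eq_zero_iff_eq_neg,
    ← intervalIntegral.integral_add hi1 hi2]
  ext i
  rw [EuclideanSpace.intervalIntegral_apply (hi1.add hi2)]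
  -- The product rule in each coordinate; the boundary terms vanish because `ψ` is zero at `a` and
  -- `c`.
  have h := integral_mul_add_mul_primitive (hψ'.intervalIntegrable a c)
    (EuclideanSpace.intervalIntegrable_apply hw i) 0 (k i)
  simp only [zero_add, hprim, hψc, zero_mul, sub_zero] at h
  rw [PiLp.zero_apply, ← h]
  refine intervalIntegral.integral_congr fun s hs => ?_
  simp only [PiLp.add_apply, PiLp.smul_apply, smul_eq_mul]
  rw [EuclideanSpace.intervalIntegral_apply (hw.mono_set (uIcc_subset_uIcc left_mem_uIcc hs))]

theorem HasWeakDeriv.congr_ae {a c : ℝ} {u u' v v' : ℝ → Vec n} (h : HasWeakDeriv a c u v)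
    (hu : u =ᵐ[volOn a c] u') (hv : v =ᵐ[volOn a c] v') : HasWeakDeriv a c u' v' := by
  intro ψ h1 h2 h3
  rw [integral_congr_ae (g := fun t => deriv ψ t • u t)
    (by filter_upwards [hu] with t ht; rw [ht]),
    integral_congr_ae (f := fun t => ψ t • v' t) (g := fun t => ψ t • v t)
    (by filter_upwards [hv] with t ht; rw [ht])]
  exact h ψ h1 h2 h3

/-- A smooth compactly supported function in an interval with mean zero is the derivative of such a
function. -/
theorem exists_deriv_eq_of_integral_eq_zero {a c : ℝ} {ζ : ℝ → ℝ} (hζ : ContDiff ℝ ∞ ζ)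
    (hs : HasCompactSupport ζ) (hsupp : tsupport ζ ⊆ Ioo a c) (h0 : ∫ t in a..c, ζ t = 0) :
    ∃ ψ : ℝ → ℝ, ContDiff ℝ ∞ ψ ∧ HasCompactSupport ψ ∧ tsupport ψ ⊆ Ioo a c ∧ deriv ψ = ζ := by
  rcases (tsupport ζ).eq_empty_or_nonempty with he | hne
  · have : ζ = 0 := tsupport_eq_empty_iff.1 he
    exact ⟨0, contDiff_const, HasCompactSupport.zero, by simp [tsupport_eq_empty_iff.2 rfl], by
      rw [this]; funext t; simp⟩
  obtain ⟨α, hα, hαle⟩ := hs.isCompact.exists_isLeast hne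
  obtain ⟨β, hβ, hβle⟩ := hs.isCompact.exists_isGreatest hne
  have hα' := hsupp hα
  have hβ' := hsupp hβ
  have hzero (t : ℝ) (ht : t ∉ Icc α β) : ζ t = 0 :=
    image_eq_zero_of_notMem_tsupport fun h => ht ⟨hαle h, hβle h⟩
  have hd (x : ℝ) : HasDerivAt (fun x => ∫ s in a..x, ζ s) (ζ x) x :=
    intervalIntegral.integral_hasDerivAt_right (hζ.continuous.intervalIntegrable _ _)
      (hζ.continuous.stronglyMeasurableAtFilter _ _) hζ.continuous.continuousAt
  have hderiv : deriv (fun x => ∫ s in a..x, ζ s) = ζ := funext fun x => (hd x).deriv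
  have hsub : Function.support (fun x => ∫ s in a..x, ζ s) ⊆ Icc α β := by
    intro x hx
    by_contra hxn
    refine hx ?_
    -- Left of the support of `ζ` nothing has been integrated yet; right of it the whole integral
    -- has, which is zero.
    rcases lt_or_ge x α with h | h
    · refine intervalIntegral.integral_zero_ae (.of_forall fun s hs => hzero s fun h' => ?_)
      exact absurd (h'.1.trans hs.2) (not_le.2 (max_lt hα'.1 h))
    · have hβx : β < x := by
        by_contra hle
        exact hxn ⟨h, not_lt.1 hle⟩
      have : ∫ s in x..c, ζ s = 0 := by
        refine intervalIntegral.integral_zero_ae (.of_forall fun s hs => hzero s fun h' => ?_)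
        exact absurd ((lt_min hβx hβ'.2).trans hs.1) (not_lt.2 h'.2)
      have hadd := intervalIntegral.integral_add_adjacent_intervals
        (hζ.continuous.intervalIntegrable (μ := volume) a x)
        (hζ.continuous.intervalIntegrable (μ := volume) x c)
      rw [this, h0, add_zero] at hadd
      exact hadd
  have htsub := closure_minimal hsub isClosed_Icc
  refine ⟨fun x => ∫ s in a..x, ζ s, ?_, ?_, ?_, hderiv⟩
  · rw [contDiff_infty_iff_deriv]
    exact ⟨fun x => (hd x).differentiableAt, by rwa [hderiv]⟩
  · exact isCompact_Icc.of_isClosed_subset (isClosed_tsupport _) htsub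
  · exact htsub.trans fun x hx => ⟨hα'.1.trans_le hx.1, hx.2.trans_lt hβ'.2⟩

theorem exists_test_integral_eq_one {a c : ℝ} (hac : a < c) :
    ∃ η : ℝ → ℝ, ContDiff ℝ ∞ η ∧ HasCompactSupport η ∧ tsupport η ⊆ Ioo a c ∧
      ∫ t in a..c, η t = 1 := by
  let B : ContDiffBump ((a + c) / 2) :=
    { rIn := (c - a) / 8, rOut := (c - a) / 4, rIn_pos := by linarith, rIn_lt_rOut := by linarith }
  have hsupp : tsupport (B.normed volume) ⊆ Ioo a c := by
    rw [B.tsupport_normed_eq, Real.closedBall_eq_Icc]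
    intro x hx
    simp only [B, mem_Icc] at hx
    exact ⟨by linarith [hx.1], by linarith [hx.2]⟩
  refine ⟨B.normed volume, B.contDiff_normed, B.hasCompactSupport_normed, hsupp, ?_⟩
  rw [← integral_volOn_eq hac.le, setIntegral_eq_integral_of_forall_compl_eq_zero, B.integral_normed]
  exact fun x hx => image_eq_zero_of_notMem_tsupport fun h => hx (hsupp h)

/-- The lemma of du Bois-Reymond. -/
theorem HasWeakDeriv.exists_ae_eq_const {a c : ℝ} (hac : a < c) {d : ℝ → Vec n}
    (hd : IntegrableOn d (Ioo a c)) (h : HasWeakDeriv a c d 0) :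
    ∃ k, ∀ᵐ t ∂(volOn a c), d t = k := by
  obtain ⟨η₀, h1, h2, h3, h4⟩ := exists_test_integral_eq_one hac
  have hint (χ : ℝ → ℝ) (hc : Continuous χ) (hs : HasCompactSupport χ) :
      Integrable (fun t => χ t • d t) (volOn a c) := by
    obtain ⟨C, hC⟩ := hs.exists_bound_of_continuous hc
    exact Integrable.bdd_smul hd C hc.aestronglyMeasurable (.of_forall hC)
  refine ⟨∫ t, η₀ t • d t ∂(volOn a c), ?_⟩
  set k := ∫ t, η₀ t • d t ∂(volOn a c) with hk
  have hloc : LocallyIntegrableOn (fun t => d t - k) (Ioo a c) :=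
    (hd.sub (integrable_const k)).locallyIntegrableOn
  have key := isOpen_Ioo.ae_eq_zero_of_integral_contDiff_smul_eq_zero (μ := volume) hloc (by
    intro η e1 e2 e3
    -- Subtracting `m * η₀` gives `η` mean zero, so the result is the derivative of a test function
    -- and is annihilated by `d`.
    set m := ∫ t in a..c, η t with hm
    have hzs : Function.support (fun t => η t - m * η₀ t) ⊆ tsupport η ∪ tsupport η₀ := by
      intro x hx
      by_contra hn
      rw [mem_union, not_or] at hn
      refine hx ?_
      simp [image_eq_zero_of_notMem_tsupport hn.1, image_eq_zero_of_notMem_tsupport hn.2]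
    have hts := closure_minimal hzs ((isClosed_tsupport η).union (isClosed_tsupport η₀))
    obtain ⟨ψ, p1, p2, p3, p4⟩ := exists_deriv_eq_of_integral_eq_zero
      (a := a) (c := c) (ζ := fun t => η t - m * η₀ t) (e1.sub (contDiff_const.mul h1))
      ((e2.isCompact.union h2.isCompact).of_isClosed_subset (isClosed_tsupport _) hts)
      (hts.trans (union_subset e3 h3)) (by
        have hc : Continuous fun t => m * η₀ t := continuous_const.mul h1.continuous
        rw [intervalIntegral.integral_sub (e1.continuous.intervalIntegrable _ _)
          (hc.intervalIntegrable _ _),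
          intervalIntegral.integral_const_mul, h4, mul_one, sub_self])
    have hw := h ψ p1 p2 p3
    simp only [p4, Pi.zero_apply, smul_zero, integral_zero, neg_zero, sub_smul, mul_smul] at hw
    have hm0 : Integrable (fun t => m • η₀ t • d t) (volOn a c) :=
      (hint η₀ h1.continuous h2).smul m
    rw [integral_sub (hint η e1.continuous e2) hm0,
      integral_smul, ← hk] at hw
    have hηi : Integrable η (volOn a c) := (e1.continuous.integrable_of_hasCompactSupport e2).restrict
    have e : ∫ t, η t • (d t - k) = ∫ t, η t • (d t - k) ∂(volOn a c) := by
      rw [setIntegral_eq_integral_of_forall_compl_eq_zero]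
      intro x hx
      rw [image_eq_zero_of_notMem_tsupport fun h => hx (e3 h), zero_smul]
    rw [e]
    simp only [smul_sub]
    rw [integral_sub (hint η e1.continuous e2) (hηi.smul_const k), integral_smul_const,
      integral_volOn_eq hac.le η, ← hm]
    exact hw)
  rw [volOn, ae_restrict_iff' measurableSet_Ioo]
  filter_upwards [key] with t ht hmem
  exact sub_eq_zero.1 (ht hmem)

/-- The difference of `u` and the primitive of `v` has weak derivative zero, so it is a.e. constant,
and everywhere by continuity. -/
theorem eq_const_add_primitive_of_hasWeakDeriv {a c : ℝ} (hac : a < c) {u v : ℝ → Vec n}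
    (hu : ContinuousOn u (Icc a c)) (hv : MemLp v 2 (volOn a c)) (h : HasWeakDeriv a c u v) :
    ∀ t ∈ Icc a c, u t = u a + ∫ s in a..t, v s := by
  have hvi : IntervalIntegrable v volume a c := by
    rw [intervalIntegrable_iff_integrableOn_Ioo_of_le hac.le]
    exact integrable_of_memLp_two hv
  have hP : ContinuousOn (fun t => (0 : Vec n) + ∫ s in a..t, v s) (Icc a c) := by
    rw [← uIcc_of_le hac.le]
    exact hvi.continuousOn_const_add_primitive 0
  have hw := hasWeakDeriv_const_add_primitive hac.le hvi 0
  have hui : IntegrableOn u (Ioo a c) := hu.integrableOn_Icc.mono_set Ioo_subset_Icc_self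
  have hPi : IntegrableOn (fun t => (0 : Vec n) + ∫ s in a..t, v s) (Ioo a c) :=
    hP.integrableOn_Icc.mono_set Ioo_subset_Icc_self
  have hd : HasWeakDeriv a c (fun t => u t - (0 + ∫ s in a..t, v s)) 0 := by
    intro ψ h1 h2 h3
    have hint (w : ℝ → Vec n) (hw : IntegrableOn w (Ioo a c)) :
        Integrable (fun t => deriv ψ t • w t) (volOn a c) := by
      have hc : Continuous (deriv ψ) := h1.continuous_deriv (by simp)
      obtain ⟨C, hC⟩ := h2.deriv.exists_bound_of_continuous hc
      exact Integrable.bdd_smul hw C hc.aestronglyMeasurable (.of_forall hC)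
    simp only [smul_sub, Pi.zero_apply, smul_zero, integral_zero, neg_zero]
    rw [integral_sub (hint _ hui) (hint _ hPi), h ψ h1 h2 h3, hw ψ h1 h2 h3, sub_self]
  obtain ⟨k, hk⟩ := hd.exists_ae_eq_const hac (hui.sub hPi)
  have heq : EqOn (fun t => u t - (0 + ∫ s in a..t, v s)) (fun _ => k) (Icc a c) :=
    Measure.eqOn_Icc_of_ae_eq volume hac.ne
      (by rwa [volOn, restrict_Ioo_eq_restrict_Icc] at hk) (hu.sub hP) continuousOn_const
  have ha : u a = k := by simpa using heq (left_mem_Icc.2 hac.le)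
  intro t ht
  have := heq ht
  simp only [zero_add] at this
  rw [ha, ← this]
  abel

end WeakDerivative

/-! ### From `L²(0, T)` to `H¹_{[0]}(-b, T)` -/

section Embedding

variable {n : ℕ}

/-- The operator `v ↦ (∫₀ᵗ v, v)` from `L²(0, T)` to `L²(-b, T) × L²(-b, T)`. -/
def primitivePair (b T : ℝ) : L2 n 0 T →L[ℝ] WithLp 2 (L2 n (-b) T × L2 n (-b) T) :=
  (WithLp.prodContinuousLinearEquiv 2 ℝ _ _).symm.toContinuousLinearMap.comp
    (((bcfToL2 (-b) T).comp (primitive 0 T)).prod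
      ((restrictL2 (-b) T).comp (extendZero 0 T).toContinuousLinearMap))

theorem primitivePair_fst (b T : ℝ) (v : L2 n 0 T) :
    (primitivePair b T v).fst = bcfToL2 (-b) T (primitive 0 T v) := rfl

theorem primitivePair_snd (b T : ℝ) (v : L2 n 0 T) :
    (primitivePair b T v).snd = restrictL2 (-b) T (extendZero 0 T v) := rfl

theorem primitivePair_mem_H1 {b T : ℝ} (hbT : -b ≤ T) (v : L2 n 0 T) :
    primitivePair b T v ∈ H1 n (-b) T := by
  change HasWeakDeriv (-b) T (primitivePair b T v).fst (primitivePair b T v).snd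
  rw [primitivePair_fst, primitivePair_snd]
  have h := hasWeakDeriv_const_add_primitive hbT
    (Lp.intervalIntegrable_volume (extendZero 0 T v) (-b) T)
    -- This constant moves the base point of the primitive from `-b` to `0`.
    (∫ s in (0 : ℝ)..(-b), extendZero 0 T v s)
  refine h.congr_ae ?_ (coeFn_restrictL2 _).symm
  have h1 := coeFn_bcfToL2 (a := -b) (c := T) (primitive 0 T v)
  filter_upwards [h1] with t ht
  rw [ht, primitive_eq_extendZero, intervalIntegral.integral_add_adjacent_intervals
    (Lp.intervalIntegrable_volume _ _ _) (Lp.intervalIntegrable_volume _ _ _)]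

/-- The element of `H¹_{[0]}(-b, T)` with derivative `v` on `(0, T)`. -/
def primitiveH1Zero {b T : ℝ} (hbT : -b ≤ T) (v : L2 n 0 T) : H1Zero n b T :=
  ⟨⟨primitivePair b T v, primitivePair_mem_H1 hbT v⟩, by
    change ∀ᵐ t ∂(volOn (-b) T), t ≤ 0 → (primitivePair b T v).fst t = 0
    rw [primitivePair_fst]
    filter_upwards [coeFn_bcfToL2 (a := -b) (c := T) (primitive 0 T v)] with t ht h0
    rw [ht, primitive_zero_left v h0]⟩

theorem primitiveH1Zero_fst {b T : ℝ} (hbT : -b ≤ T) (v : L2 n 0 T) :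
    (primitiveH1Zero hbT v).1.1.fst = bcfToL2 (-b) T (primitive 0 T v) := rfl

theorem norm_primitivePair_le (b T : ℝ) (v : L2 n 0 T) :
    ‖primitivePair b T v‖ ≤
      (‖bcfToL2 (E := Vec n) (-b) T‖ * ‖primitive (E := Vec n) 0 T‖ + 1) * ‖v‖ := by
  rw [WithLp.prod_norm_eq_of_L2, primitivePair_fst, primitivePair_snd, add_mul, one_mul]
  have h1 : ‖bcfToL2 (-b) T (primitive 0 T v)‖ ≤
      ‖bcfToL2 (E := Vec n) (-b) T‖ * ‖primitive (E := Vec n) 0 T‖ * ‖v‖ := by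
    rw [mul_assoc]
    exact ((bcfToL2 (E := Vec n) (-b) T).le_opNorm _).trans
      (mul_le_mul_of_nonneg_left ((primitive (E := Vec n) 0 T).le_opNorm v) (norm_nonneg _))
  have h2 : ‖restrictL2 (-b) T (extendZero 0 T v)‖ ≤ ‖v‖ :=
    (norm_restrictL2_le (extendZero 0 T v)).trans_eq ((extendZero 0 T).norm_map v)
  refine Real.sqrt_le_iff.2 ⟨by positivity, ?_⟩
  have h3 := norm_nonneg (bcfToL2 (-b) T (primitive 0 T v))
  have h4 := norm_nonneg (restrictL2 (-b) T (extendZero 0 T v))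
  nlinarith [mul_nonneg h3 h4, pow_le_pow_left₀ (add_nonneg h3 h4) (add_le_add h1 h2) 2]

theorem isBoundedLinearMap_primitiveH1Zero {b T : ℝ} (hbT : -b ≤ T) :
    IsBoundedLinearMap ℝ fun v : L2 n 0 T => primitiveH1Zero hbT v :=
  IsLinearMap.with_bound
    ⟨fun v w => Subtype.ext (Subtype.ext (map_add (primitivePair b T) v w)),
      fun c v => Subtype.ext (Subtype.ext (map_smul (primitivePair b T) c v))⟩
    _ (fun v => norm_primitivePair_le b T v)

theorem contDiff_primitiveH1Zero {b T : ℝ} (hbT : -b ≤ T) :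
    ContDiff ℝ 1 fun v : L2 n 0 T => primitiveH1Zero hbT v :=
  IsBoundedLinearMap.contDiff (isBoundedLinearMap_primitiveH1Zero hbT)

end Embedding

/-! ### Grönwall with delay, one-sided growth and truncation -/

section AprioriBound

/-- A Grönwall inequality with delay. -/
theorem le_of_le_add_integral_delay {T C K τ : ℝ} (hT : 0 ≤ T) (hK : 0 ≤ K)
    (hτ : 0 ≤ τ) {y r q : ℝ → ℝ} (hy : ContinuousOn y (Icc 0 T)) (hy0 : ∀ t, 0 ≤ y t)
    (hq : Integrable q (volOn 0 T)) (hq0 : ∀ t, 0 ≤ q t) (hr : IntervalIntegrable r volume 0 T)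
    (hyr : ∀ t ∈ Icc 0 T, y t ≤ C + ∫ s in (0 : ℝ)..t, r s)
    (hrq : ∀ᵐ s ∂(volOn 0 T), r s ≤ q s + K * (y s + y (max (s - τ) 0))) :
    ∀ t ∈ Icc 0 T, y t ≤ 2 * (C + ∫ s, q s ∂(volOn 0 T)) * Real.exp ((4 * K + 1) * T) := by
  set L := 4 * K + 1 with hL
  have hLpos : 0 < L := by positivity
  set C₁ := C + ∫ s, q s ∂(volOn 0 T) with hC₁
  -- The inequality is used only at a maximum point of `exp (-L s) * y s`; there the maximal value
  -- `D` controls `y` at present and delayed times alike.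
  obtain ⟨t₀, ht₀, hmax⟩ := isCompact_Icc.exists_isMaxOn (nonempty_Icc.2 hT)
    ((by fun_prop : Continuous fun s => Real.exp (-(L * s))).continuousOn.mul hy)
  set D := Real.exp (-(L * t₀)) * y t₀ with hD
  have hD0 : 0 ≤ D := mul_nonneg (Real.exp_pos _).le (hy0 _)
  have hDy : D * Real.exp (L * t₀) = y t₀ := by
    rw [hD, mul_right_comm, ← Real.exp_add, neg_add_cancel, Real.exp_zero, one_mul]
  have hyD (s : ℝ) (hs : s ∈ Icc 0 T) : y s ≤ D * Real.exp (L * s) := by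
    have h := hmax hs
    simp only [mem_ofPred_eq] at h
    calc y s = Real.exp (-(L * s)) * y s * Real.exp (L * s) := by
          rw [mul_right_comm, ← Real.exp_add, neg_add_cancel, Real.exp_zero, one_mul]
      _ ≤ D * Real.exp (L * s) := by gcongr; exact h
  have hsub : IntervalIntegrable r volume 0 t₀ :=
    hr.mono_set (by rw [uIcc_of_le ht₀.1, uIcc_of_le hT]; exact Icc_subset_Icc_right ht₀.2)
  have hqi : IntervalIntegrable q volume 0 T := by
    rw [intervalIntegrable_iff_integrableOn_Ioo_of_le hT]
    exact hq
  have hqt : IntervalIntegrable q volume 0 t₀ :=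
    hqi.mono_set (by rw [uIcc_of_le ht₀.1, uIcc_of_le hT]; exact Icc_subset_Icc_right ht₀.2)
  have he : IntervalIntegrable (fun s => 2 * K * D * Real.exp (L * s)) volume 0 t₀ :=
    (by fun_prop : Continuous fun s => 2 * K * D * Real.exp (L * s)).intervalIntegrable _ _
  have hint : ∫ s in (0 : ℝ)..t₀, r s ≤
      ∫ s in (0 : ℝ)..t₀, (q s + 2 * K * D * Real.exp (L * s)) := by
    rw [← intervalIntegral_volOn_of_mem ⟨le_rfl, hT⟩ ht₀,
      ← intervalIntegral_volOn_of_mem ⟨le_rfl, hT⟩ ht₀]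
    refine intervalIntegral.integral_mono_ae ht₀.1 ?_ ?_ ?_
    · exact ⟨hsub.1.mono_measure Measure.restrict_le_self,
        hsub.2.mono_measure Measure.restrict_le_self⟩
    · exact ⟨(hqt.add he).1.mono_measure Measure.restrict_le_self,
        (hqt.add he).2.mono_measure Measure.restrict_le_self⟩
    · filter_upwards [hrq, ae_restrict_mem measurableSet_Ioo] with s hs hsm
      have h1 := hyD s (Ioo_subset_Icc_self hsm)
      have h2 := hyD (max (s - τ) 0) ⟨le_max_right _ _, max_le (by linarith [hsm.2]) hT⟩
      have h3 : Real.exp (L * max (s - τ) 0) ≤ Real.exp (L * s) := by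
        have : max (s - τ) 0 ≤ s := max_le (by linarith) hsm.1.le
        gcongr
      have h4 : D * Real.exp (L * max (s - τ) 0) ≤ D * Real.exp (L * s) := by gcongr
      calc r s ≤ q s + K * (y s + y (max (s - τ) 0)) := hs
        _ ≤ q s + K * (D * Real.exp (L * s) + D * Real.exp (L * s)) := by
          gcongr
          exact h2.trans h4
        _ = _ := by ring
  have hqle : ∫ s in (0 : ℝ)..t₀, q s ≤ ∫ s, q s ∂(volOn 0 T) := by
    rw [integral_volOn_eq hT]
    exact intervalIntegral.integral_mono_interval le_rfl ht₀.1 ht₀.2 (.of_forall hq0) hqi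
  rw [intervalIntegral.integral_add hqt he, intervalIntegral.integral_const_mul] at hint
  have hexp := integral_exp_mul_le hLpos t₀
  -- Since `2 K ≤ L / 2`, the integral terms amount to at most half of `y t₀` and are absorbed on
  -- the left.
  have h5 : 2 * K * D * ∫ s in (0 : ℝ)..t₀, Real.exp (L * s) ≤ y t₀ / 2 := by
    calc 2 * K * D * ∫ s in (0 : ℝ)..t₀, Real.exp (L * s)
        ≤ 2 * K * D * (Real.exp (L * t₀) / L) := by gcongr
      _ ≤ (L / 2) * D * (Real.exp (L * t₀) / L) := by gcongr; linarith
      _ = (D * Real.exp (L * t₀)) / 2 := by field_simp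
      _ = y t₀ / 2 := by rw [hDy]
  have h6 : y t₀ ≤ 2 * C₁ := by
    have := hyr t₀ ht₀
    linarith
  have hC₁0 : 0 ≤ C₁ := by linarith [hy0 t₀]
  have h7 : D ≤ 2 * C₁ := by
    refine le_trans ?_ h6
    rw [← hDy]
    exact le_mul_of_one_le_right hD0 (Real.one_le_exp (mul_nonneg hLpos.le ht₀.1))
  intro t ht
  have h8 : Real.exp (L * t) ≤ Real.exp (L * T) := by
    have := ht.2
    gcongr
  calc y t ≤ D * Real.exp (L * t) := hyD t ht
    _ ≤ 2 * C₁ * Real.exp (L * T) := by gcongr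

variable {n : ℕ}

/-- A one-sided bound on the derivative yields a one-sided growth bound. -/
theorem inner_apply_self_ge {f : Vec n → Vec n} (hf : ContDiff ℝ 1 f) {lam : ℝ}
    (hmono : ∀ x v : Vec n, 0 ≤ inner ℝ (fderiv ℝ f x v + lam • v) v) (x : Vec n) :
    -(‖f 0‖ * ‖x‖ + lam * ‖x‖ ^ 2) ≤ inner ℝ (f x) x := by
  have hd (s : ℝ) : HasDerivAt (fun s : ℝ => inner ℝ (f (s • x) + lam • s • x) x)
      (inner ℝ (fderiv ℝ f (s • x) x + lam • x) x) s := by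
    have h1 : HasDerivAt (fun s : ℝ => s • x) x s := by
      simpa using (hasDerivAt_id s).smul_const x
    have h2 := ((hf.differentiable one_ne_zero (s • x)).hasFDerivAt.comp_hasDerivAt s h1)
    have h3 := (h2.add (h1.const_smul lam)).inner ℝ (hasDerivAt_const s x)
    simpa using h3
  -- The hypothesis says that `f + lam • id` is monotone along the ray through `x`; comparing `s =
  -- 0` with `s = 1` gives the bound.
  have hm : Monotone fun s : ℝ => inner ℝ (f (s • x) + lam • s • x) x :=
    monotone_of_deriv_nonneg (fun s => (hd s).differentiableAt)
      (fun s => by rw [(hd s).deriv]; exact hmono _ _)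
  have h := hm zero_le_one
  simp only [zero_smul, smul_zero, add_zero, one_smul, inner_add_left, real_inner_smul_left,
    real_inner_self_eq_norm_sq] at h
  have h' := neg_le_of_abs_le (abs_real_inner_le_norm (f 0) x)
  linarith

/-- A function vanishing far away that coincides with `f` in a ball. -/
theorem exists_truncation {f : Vec n → Vec n} (hf : ContDiff ℝ 1 f) {a lam : ℝ} (ha : 0 ≤ a)
    (hlam : 0 ≤ lam) (hfx : ∀ x, -(a * ‖x‖ + lam * ‖x‖ ^ 2) ≤ inner ℝ (f x) x) (R : ℝ) :
    ∃ h : Vec n → Vec n, ContDiff ℝ 1 h ∧ HasCompactSupport h ∧ (∀ x, ‖x‖ ≤ R → h x = f x) ∧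
      ∀ x, -(a * ‖x‖ + lam * ‖x‖ ^ 2) ≤ inner ℝ (h x) x := by
  let B : ContDiffBump (0 : Vec n) :=
    { rIn := max R 1, rOut := max R 1 + 1, rIn_pos := by positivity, rIn_lt_rOut := by linarith }
  refine ⟨fun x => B x • f x, B.contDiff.smul hf, B.hasCompactSupport.smul_right,
    fun x hx => ?_, fun x => ?_⟩
  · dsimp only
    rw [B.one_of_mem_closedBall, one_smul]
    rw [mem_closedBall_zero_iff]
    exact hx.trans (le_max_left _ _)
  · rw [real_inner_smul_left]
    have h0 := B.nonneg (x := x)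
    have h1 := B.le_one (x := x)
    have h2 : 0 ≤ a * ‖x‖ + lam * ‖x‖ ^ 2 := by positivity
    -- A nonpositive lower bound survives multiplication by a factor in `[0, 1]`. The condition on
    -- the derivative need not, which is why the growth form is used.
    calc -(a * ‖x‖ + lam * ‖x‖ ^ 2) ≤ B x * -(a * ‖x‖ + lam * ‖x‖ ^ 2) := by nlinarith
      _ ≤ _ := by gcongr; exact hfx x

end AprioriBound

/-! ### Solutions as trajectories, and the a priori bound -/

section Trajectory

variable {n : ℕ}

/-- The function that continues the history `φ` with derivative `v` on `(0, T)`. -/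
def trajectory {T : ℝ} (φ : ℝ → Vec n) (v : L2 n 0 T) (t : ℝ) : Vec n :=
  φ (min t 0) + primitive 0 T v t

theorem trajectory_of_nonpos {T t : ℝ} (φ : ℝ → Vec n) (v : L2 n 0 T) (ht : t ≤ 0) :
    trajectory φ v t = φ t := by
  rw [trajectory, min_eq_left ht, primitive_zero_left v ht, add_zero]

theorem trajectory_of_nonneg {T t : ℝ} (φ : ℝ → Vec n) (v : L2 n 0 T) (ht : 0 ≤ t) :
    trajectory φ v t = φ 0 + primitive 0 T v t := by
  rw [trajectory, min_eq_right ht]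

theorem continuousOn_trajectory {b T : ℝ} {φ : ℝ → Vec n} (hb : 0 ≤ b)
    (hφ : ContinuousOn φ (Icc (-b) 0)) (v : L2 n 0 T) :
    ContinuousOn (trajectory φ v) (Icc (-b) T) := by
  refine ContinuousOn.add (hφ.comp (by fun_prop) fun t ht => ?_)
    (primitive 0 T v).continuous.continuousOn
  exact ⟨le_min ht.1 (by linarith), min_le_right _ _⟩

theorem primitive_eq_intervalIntegral {T t : ℝ} (v : L2 n 0 T) (ht : t ∈ Icc 0 T) :
    primitive 0 T v t = ∫ s in (0 : ℝ)..t, v s :=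
  intervalIntegral_volOn_of_mem ⟨le_rfl, ht.1.trans ht.2⟩ ht

theorem intervalIntegrable_of_L2 {T : ℝ} (hT : 0 ≤ T) (v : L2 n 0 T) :
    IntervalIntegrable v volume 0 T := by
  rw [intervalIntegrable_iff_integrableOn_Ioo_of_le hT]
  exact Lp.integrable_volOn v

theorem isH1Pair_trajectory {T : ℝ} (hT : 0 ≤ T) (φ : ℝ → Vec n) (v : L2 n 0 T) :
    IsH1Pair 0 T (trajectory φ v) v := by
  have heq : (fun t => φ 0 + ∫ s in (0 : ℝ)..t, v s) =ᵐ[volOn 0 T] trajectory φ v := by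
    filter_upwards [ae_restrict_mem measurableSet_Ioo] with t ht
    rw [trajectory_of_nonneg φ v ht.1.le, primitive_eq_intervalIntegral v (Ioo_subset_Icc_self ht)]
  refine ⟨?_, Lp.memLp v, ?_⟩
  · have h : MemLp (fun t => φ 0 + primitive 0 T v t) 2 (volOn 0 T) :=
      (memLp_const (φ 0)).add ((memLp_congr_ae (coeFn_bcfToL2 (primitive 0 T v))).1 (Lp.memLp _))
    refine (memLp_congr_ae ?_).1 h
    filter_upwards [ae_restrict_mem measurableSet_Ioo] with t ht
    rw [trajectory_of_nonneg φ v ht.1.le]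
  · exact (hasWeakDeriv_const_add_primitive hT (intervalIntegrable_of_L2 hT v) (φ 0)).congr_ae
      heq ae_eq_rfl

/-- The weak derivative of the history, extended by zero to the real line. -/
theorem exists_extended_weakDeriv {b : ℝ} (hb : 0 < b) {φ : ℝ → Vec n} (hφ : MemH1 (-b) 0 φ)
    (hφc : ContinuousOn φ (Icc (-b) 0)) :
    ∃ p : Lp (Vec n) 2 (volume : Measure ℝ),
      (∀ t ∈ Icc (-b) 0, ∫ s in (0 : ℝ)..t, p s = φ t - φ 0) ∧
      ∀ t, 0 ≤ t → ∫ s in (0 : ℝ)..t, p s = 0 := by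
  obtain ⟨w, hw⟩ := hφ
  have hb' : -b < 0 := by linarith
  have hrep := eq_const_add_primitive_of_hasWeakDeriv hb' hφc hw.memLp_deriv hw.weakDeriv
  have hwi : IntervalIntegrable w volume (-b) 0 := by
    rw [intervalIntegrable_iff_integrableOn_Ioo_of_le hb'.le]
    exact integrable_of_memLp_two hw.memLp_deriv
  refine ⟨extendZero (-b) 0 (hw.memLp_deriv.toLp w), fun t ht => ?_, fun t ht => ?_⟩
  · rw [← primitive_eq_extendZero, primitive_apply,
      intervalIntegral.integral_congr_ae (g := w)
        (by filter_upwards [hw.memLp_deriv.coeFn_toLp] with s hs _ using hs),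
      intervalIntegral_volOn_of_mem ⟨hb'.le, le_rfl⟩ ht, hrep t ht, hrep 0 ⟨hb'.le, le_rfl⟩,
      add_sub_add_left_eq_sub,
      intervalIntegral.integral_interval_sub_left _ hwi]
    exact hwi.mono_set (by
      rw [uIcc_of_le ht.1, uIcc_of_le hb'.le]
      exact Icc_subset_Icc_right ht.2)
  · rw [← primitive_eq_extendZero, primitive_apply, intervalIntegral_volOn,
      intervalIntegral.integral_of_le ht, setIntegral_eq_zero_of_forall_eq_zero]
    intro s hs
    exact indicator_of_notMem (fun h => absurd h.2 (not_lt.2 hs.1.le)) _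

/-- `p` plus the extension of `v` is the derivative of the trajectory on `(-b, T)`, so its primitive
from `0` is the trajectory minus `φ 0`; `τ ≤ b` keeps `t - τ` in the range of the history. -/
theorem coeFn_delayPrimitive_trajectory {b T τ : ℝ} {φ : ℝ → Vec n}
    {p : Lp (Vec n) 2 (volume : Measure ℝ)}
    (hp : ∀ t ∈ Icc (-b) 0, ∫ s in (0 : ℝ)..t, p s = φ t - φ 0)
    (hp' : ∀ t, 0 ≤ t → ∫ s in (0 : ℝ)..t, p s = 0) (hτ : τ ≤ b) (v : L2 n 0 T) :
    delayPrimitive T τ (p + extendZero 0 T v) =ᵐ[volOn 0 T]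
      fun t => trajectory φ v (t - τ) - φ 0 := by
  rw [map_add, delayPrimitive_extendZero]
  have h1 := coeFn_delayPrimitive T τ p
  have h2 := coeFn_bcfToL2 (a := 0) (c := T) (delayPos τ (primitive 0 T v))
  have h3 := Lp.coeFn_add (delayPrimitive T τ p) (bcfToL2 0 T (delayPos τ (primitive 0 T v)))
  filter_upwards [h1, h2, h3, ae_restrict_mem measurableSet_Ioo] with t h1 h2 h3 ht
  rw [h3, Pi.add_apply, h1, h2, delayPos_apply]
  rcases le_total (t - τ) 0 with h | h
  · rw [trajectory_of_nonpos φ v h, hp _ ⟨by linarith [ht.1], h⟩, max_eq_right h,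
      primitive_zero_left v le_rfl, add_zero]
  · rw [trajectory_of_nonneg φ v h, hp' _ h, max_eq_left h]
    abel

/-- The delayed primitive misses the constant `φ 0`, and the term `A (φ 0)` in `G` restores it. -/
theorem delayResidual_eq_zero_iff {b T τ : ℝ} {φ : ℝ → Vec n}
    {p : Lp (Vec n) 2 (volume : Measure ℝ)}
    (hp : ∀ t ∈ Icc (-b) 0, ∫ s in (0 : ℝ)..t, p s = φ t - φ 0)
    (hp' : ∀ t, 0 ≤ t → ∫ s in (0 : ℝ)..t, p s = 0) (hτ : τ ≤ b)
    {h : Vec n → Vec n} (hd : ContDiff ℝ 1 h) (hs : HasCompactSupport h)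
    (A : Vec n →L[ℝ] Vec n) {g : ℝ → Vec n} {G : L2 n 0 T}
    (hG : G =ᵐ[volOn 0 T] fun t => g t + A (φ 0)) (v : L2 n 0 T) :
    delayResidual T hd hs A p G (τ, v) = 0 ↔
      ∀ᵐ t ∂(volOn 0 T), v t + h (primitive 0 T v t) = A (trajectory φ v (t - τ)) + g t := by
  rw [Lp.eq_zero_iff_ae_eq_zero, delayResidual]
  dsimp only
  refine eventually_congr ?_
  have h1 := coeFn_bcfToL2 (a := 0) (c := T) (superposition h hd.continuous hs (primitive 0 T v))
  have h2 := coeFn_delayPrimitive_trajectory hp hp' hτ v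
  have h3 := A.coeFn_compLpL (p := 2) (delayPrimitive T τ (p + extendZero 0 T v))
  have h4 := Lp.coeFn_add v (bcfToL2 0 T (superposition h hd.continuous hs (primitive 0 T v)))
  have h5 := Lp.coeFn_sub (v + bcfToL2 0 T (superposition h hd.continuous hs (primitive 0 T v)))
    (mapL2 T A (delayPrimitive T τ (p + extendZero 0 T v)))
  have h6 := Lp.coeFn_sub (v + bcfToL2 0 T (superposition h hd.continuous hs (primitive 0 T v)) -
    mapL2 T A (delayPrimitive T τ (p + extendZero 0 T v))) G
  filter_upwards [h1, h2, h3, h4, h5, h6, hG] with t h1 h2 h3 h4 h5 h6 h7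
  rw [h6, Pi.sub_apply, h5, Pi.sub_apply, h4, Pi.add_apply, h3, h2, h1, h7, superposition_apply,
    map_sub, Pi.zero_apply, sub_sub, sub_eq_zero]
  rw [show A (trajectory φ v (t - τ)) - A (φ 0) + (g t + A (φ 0)) =
    A (trajectory φ v (t - τ)) + g t by abel]

/-- The energy estimate: the equation is tested with `x`, and the products with `a`, `‖g‖` and `‖y‖`
are split by Young's inequality. -/
theorem two_mul_inner_le {a lam : ℝ} (A : Vec n →L[ℝ] Vec n)
    {x v F y g : Vec n} (hv : v + F = A y + g)
    (hF : -(a * ‖x‖ + lam * ‖x‖ ^ 2) ≤ inner ℝ F x) :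
    2 * inner ℝ x v ≤ a ^ 2 + ‖g‖ ^ 2 + (2 + 2 * lam + ‖A‖) * ‖x‖ ^ 2 + ‖A‖ * ‖y‖ ^ 2 := by
  have e : v = A y + g - F := eq_sub_of_add_eq hv
  rw [e, inner_sub_right, inner_add_right, real_inner_comm F x]
  have h1 : inner ℝ x (A y) ≤ ‖A‖ * (‖x‖ * ‖y‖) := by
    calc inner ℝ x (A y) ≤ ‖x‖ * ‖A y‖ := real_inner_le_norm _ _
      _ ≤ ‖x‖ * (‖A‖ * ‖y‖) := by gcongr; exact A.le_opNorm y
      _ = _ := by ring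
  have h2 : inner ℝ x g ≤ ‖x‖ * ‖g‖ := real_inner_le_norm _ _
  have h3 : 2 * (‖A‖ * (‖x‖ * ‖y‖)) ≤ ‖A‖ * (‖x‖ ^ 2 + ‖y‖ ^ 2) := by
    nlinarith [mul_nonneg (norm_nonneg A) (sq_nonneg (‖x‖ - ‖y‖))]
  nlinarith [sq_nonneg (‖x‖ - ‖g‖), sq_nonneg (a - ‖x‖)]

/-- An a priori bound which is uniform in the delay and in the nonlinearity. -/
theorem exists_trajectory_bound {b T : ℝ} (hT : 0 ≤ T) {φ : ℝ → Vec n}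
    (hφ : ContinuousOn φ (Icc (-b) 0)) {g : ℝ → Vec n} (hg : MemLp g 2 (volOn 0 T)) {a lam : ℝ}
    (hlam : 0 ≤ lam) (A : Vec n →L[ℝ] Vec n) :
    ∃ M : ℝ, ∀ (F : Vec n → Vec n) (τ : ℝ) (v : L2 n 0 T), τ ∈ Icc 0 b →
      (∀ x, -(a * ‖x‖ + lam * ‖x‖ ^ 2) ≤ inner ℝ (F x) x) →
      (∀ᵐ t ∂(volOn 0 T), v t + F (trajectory φ v t) = A (trajectory φ v (t - τ)) + g t) →
      ∀ t ∈ Icc 0 T, ‖trajectory φ v t‖ ≤ M := by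
  obtain ⟨C, hC⟩ := isCompact_Icc.exists_bound_of_continuousOn hφ
  -- The last summand covers the times at which the delayed argument still lies in the history,
  -- where `‖φ‖ ≤ C`.
  set q : ℝ → ℝ := fun s => a ^ 2 + ‖g s‖ ^ 2 + ‖A‖ * C ^ 2 with hqdef
  have hq : Integrable q (volOn 0 T) :=
    ((integrable_const _).add (hg.integrable_norm_pow (by norm_num))).add (integrable_const _)
  set K : ℝ := 2 + 2 * lam + ‖A‖ with hK
  set B := 2 * (‖φ 0‖ ^ 2 + ∫ s, q s ∂(volOn 0 T)) * Real.exp ((4 * K + 1) * T) with hB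
  refine ⟨Real.sqrt B, fun F τ v hτ hF hv t ht => ?_⟩
  refine Real.le_sqrt_of_sq_le ?_
  rw [trajectory_of_nonneg φ v ht.1]
  have hvi := intervalIntegrable_of_L2 hT v
  have hcont : Continuous fun s => φ 0 + primitive 0 T v s :=
    continuous_const.add (primitive 0 T v).continuous
  refine le_of_le_add_integral_delay (τ := τ) (y := fun s => ‖φ 0 + primitive 0 T v s‖ ^ 2)
    (r := fun s => 2 * inner ℝ (φ 0 + primitive 0 T v s) (v s)) hT (by positivity) hτ.1
    (hcont.norm.pow 2).continuousOn (fun _ => by positivity) hq (fun s => by positivity)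
    ?_ ?_ ?_ t ht
  · obtain ⟨D, hD⟩ := isCompact_Icc.exists_bound_of_continuousOn (s := Icc 0 T) hcont.continuousOn
    rw [intervalIntegrable_iff_integrableOn_Ioo_of_le hT] at hvi ⊢
    refine Integrable.const_mul ?_ 2
    refine Integrable.mono' (hvi.norm.const_mul D)
      (hcont.aestronglyMeasurable.inner hvi.aestronglyMeasurable) ?_
    filter_upwards [ae_restrict_mem measurableSet_Ioo] with s hs
    refine (norm_inner_le_norm _ _).trans ?_
    gcongr
    exact hD s (Ioo_subset_Icc_self hs)
  · intro t ht
    have hvt : IntervalIntegrable v volume 0 t :=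
      hvi.mono_set (by rw [uIcc_of_le ht.1, uIcc_of_le hT]; exact Icc_subset_Icc_right ht.2)
    have h := norm_sq_const_add_primitive hvt (φ 0)
    rw [← primitive_eq_intervalIntegral v ht] at h
    refine (h.trans ?_).le
    congr 1
    refine intervalIntegral.integral_congr fun s hs => ?_
    rw [uIcc_of_le ht.1] at hs
    rw [primitive_eq_intervalIntegral v ⟨hs.1, hs.2.trans ht.2⟩]
  · filter_upwards [hv, ae_restrict_mem measurableSet_Ioo] with s hs hsm
    have h1 := two_mul_inner_le A hs (hF _)
    rw [trajectory_of_nonneg φ v hsm.1.le] at h1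
    refine h1.trans ?_
    have h2 : ‖trajectory φ v (s - τ)‖ ^ 2 ≤ C ^ 2 + ‖φ 0 + primitive 0 T v (max (s - τ) 0)‖ ^ 2 := by
      rcases le_total (s - τ) 0 with h | h
      · rw [trajectory_of_nonpos φ v h]
        have := hC (s - τ) ⟨by linarith [hsm.1, hτ.2], h⟩
        nlinarith [norm_nonneg (φ (s - τ)), sq_nonneg ‖φ 0 + primitive 0 T v (max (s - τ) 0)‖]
      · rw [trajectory_of_nonneg φ v h, max_eq_left h]
        nlinarith [sq_nonneg C]
    have h3 : ‖A‖ * ‖trajectory φ v (s - τ)‖ ^ 2 ≤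
        ‖A‖ * (C ^ 2 + ‖φ 0 + primitive 0 T v (max (s - τ) 0)‖ ^ 2) := by gcongr
    have h4 : ‖A‖ * ‖φ 0 + primitive 0 T v (max (s - τ) 0)‖ ^ 2 ≤
        K * ‖φ 0 + primitive 0 T v (max (s - τ) 0)‖ ^ 2 := by
      gcongr
      rw [hK]
      linarith
    simp only [hqdef]
    linarith

theorem trajectory_isDelaySolution {b T τ : ℝ} (hb : 0 ≤ b) (hT : 0 ≤ T) {φ : ℝ → Vec n}
    (hφ : ContinuousOn φ (Icc (-b) 0)) {f : Vec n → Vec n} (A : Matrix (Fin n) (Fin n) ℝ)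
    {g : ℝ → Vec n} {v : L2 n 0 T}
    (hv : ∀ᵐ t ∂(volOn 0 T),
      v t + f (trajectory φ v t) = A.toEuclideanLin (trajectory φ v (t - τ)) + g t) :
    IsDelaySolution f A g φ b T τ (trajectory φ v) :=
  ⟨continuousOn_trajectory hb hφ v, fun _ ht => trajectory_of_nonpos φ v ht.2, v,
    isH1Pair_trajectory hT φ v, hv⟩

/-- Uniqueness is claimed among all solutions, so an arbitrary one must be recovered from its weak
derivative before the `L²` equation applies to it. -/
theorem IsDelaySolution.exists_trajectory {b T τ : ℝ} (hb : 0 ≤ b) (hT : 0 < T)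
    (hτ : τ ∈ Icc 0 b) {φ : ℝ → Vec n} {f : Vec n → Vec n} {A : Matrix (Fin n) (Fin n) ℝ}
    {g x : ℝ → Vec n} (hx : IsDelaySolution f A g φ b T τ x) :
    ∃ v : L2 n 0 T, EqOn x (trajectory φ v) (Icc (-b) T) ∧ ∀ᵐ t ∂(volOn 0 T),
      v t + f (trajectory φ v t) = A.toEuclideanLin (trajectory φ v (t - τ)) + g t := by
  obtain ⟨hc, hφ, w, hw, heq⟩ := hx
  have hrep := eq_const_add_primitive_of_hasWeakDeriv hT
    (hc.mono (Icc_subset_Icc_left (by linarith))) hw.memLp_deriv hw.weakDeriv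
  have hae := hw.memLp_deriv.coeFn_toLp
  have hE : EqOn x (trajectory φ (hw.memLp_deriv.toLp w)) (Icc (-b) T) := by
    intro t ht
    rcases le_total t 0 with h | h
    · rw [trajectory_of_nonpos _ _ h]
      exact hφ ⟨ht.1, h⟩
    · rw [trajectory_of_nonneg _ _ h, hrep t ⟨h, ht.2⟩, hφ ⟨by linarith, le_rfl⟩,
        primitive_apply, ← intervalIntegral_volOn_of_mem ⟨le_rfl, hT.le⟩ ⟨h, ht.2⟩]
      congr 1
      refine intervalIntegral.integral_congr_ae ?_
      filter_upwards [hae] with s hs _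
      exact hs.symm
  refine ⟨hw.memLp_deriv.toLp w, hE, ?_⟩
  filter_upwards [heq, hae, ae_restrict_mem measurableSet_Ioo] with t h1 h2 ht
  rw [h2, ← hE ⟨by linarith [ht.1], ht.2.le⟩,
    ← hE ⟨by linarith [ht.1, hτ.2], by linarith [ht.2, hτ.1]⟩]
  exact h1

end Trajectory

end
-- The main theorem
theorem theorem3p2 (n : ℕ) (b T : ℝ) (hb : 0 < b) (hT : 0 < T)
    (f : Vec n → Vec n) (hf : ContDiff ℝ 1 f)
    (lam : ℝ) (hlam : 0 < lam)
    (hmono : ∀ x v : Vec n, 0 ≤ inner ℝ (fderiv ℝ f x v + lam • v) v)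
    (A : Matrix (Fin n) (Fin n) ℝ)
    (g : ℝ → Vec n) (hg : MemLp g 2 (volOn 0 T))
    (φ : ℝ → Vec n) (hφ : MemH1 (-b) 0 φ) (hφc : ContinuousOn φ (Icc (-b) 0)) :
    ∃ (x : ℝ → ℝ → Vec n) (z : ℝ → H1Zero n b T),
      (∀ τ ∈ Icc 0 b,
        IsDelaySolution f A g φ b T τ (x τ) ∧
        (∀ y : ℝ → Vec n, IsDelaySolution f A g φ b T τ y → EqOn y (x τ) (Icc (-b) T)) ∧
        ((z τ).1.1.fst : ℝ → Vec n) =ᵐ[volOn (-b) T] fun t => x τ t - extendInitial φ t) ∧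
      ContDiffOn ℝ 1 z (Icc 0 b) := by
  let A' : Vec n →L[ℝ] Vec n := LinearMap.toContinuousLinearMap A.toEuclideanLin
  have hfx := inner_apply_self_ge hf hmono
  obtain ⟨M, hM⟩ := exists_trajectory_bound (a := ‖f 0‖) hT.le hφc hg hlam.le A'
  -- `F` obeys the same growth bound as `f`, so `M` bounds the trajectories for both, and they agree
  -- on the ball of radius `M`.
  obtain ⟨F, hF, hFs, hFf, hFx⟩ := exists_truncation hf (norm_nonneg _) hlam.le hfx M
  obtain ⟨p, hp, hp'⟩ := exists_extended_weakDeriv hb hφ hφc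
  -- The translation by `φ 0` appears because the residual sees only `x - φ 0`, the primitive of
  -- `v`.
  have hd : ContDiff ℝ 1 fun y => F (φ 0 + y) := hF.comp (contDiff_const.add contDiff_id)
  have hs : HasCompactSupport fun y => F (φ 0 + y) :=
    hFs.comp_homeomorph (Homeomorph.addLeft (φ 0))
  have hGm : MemLp (fun t => g t + A' (φ 0)) 2 (volOn 0 T) := hg.add (memLp_const _)
  set G : L2 n 0 T := hGm.toLp _ with hGdef
  have hiff (τ : ℝ) (hτ : τ ≤ b) (v : L2 n 0 T) : delayResidual T hd hs A' p G (τ, v) = 0 ↔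
      ∀ᵐ t ∂(volOn 0 T), v t + F (trajectory φ v t) = A' (trajectory φ v (t - τ)) + g t := by
    rw [delayResidual_eq_zero_iff hp hp' hτ hd hs A' hGm.coeFn_toLp v]
    refine Filter.eventually_congr ?_
    filter_upwards [ae_restrict_mem measurableSet_Ioo] with t ht
    rw [trajectory_of_nonneg φ v ht.1.le]
  have hex (τ : ℝ) : ∃ v : L2 n 0 T, τ ∈ Icc 0 b → delayResidual T hd hs A' p G (τ, v) = 0 := by
    by_cases hτ : τ ∈ Icc 0 b
    · obtain ⟨v, hv, -⟩ := existsUnique_residual_eq_zero hT.le hτ.1 hd hs A' p G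
      exact ⟨v, fun _ => hv⟩
    -- The value for delays outside `[0, b]` is never used.
    · exact ⟨0, fun h => absurd h hτ⟩
  choose v hv using hex
  have hbT : -b ≤ T := by linarith
  have hz := (contDiff_primitiveH1Zero (n := n) hbT).comp_contDiffOn
    (contDiffOn_of_residual_eq_zero hT.le hd hs A' p G v hv)
  refine ⟨fun τ => trajectory φ (v τ), fun τ => primitiveH1Zero hbT (v τ),
    fun τ hτ => ⟨?_, ?_, ?_⟩, hz⟩
  · refine trajectory_isDelaySolution hb.le hT.le hφc A ?_
    have h1 := (hiff τ hτ.2 (v τ)).1 (hv τ hτ)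
    have h2 := hM F τ (v τ) hτ hFx h1
    filter_upwards [h1, ae_restrict_mem measurableSet_Ioo] with t h3 ht
    rw [hFf _ (h2 t (Ioo_subset_Icc_self ht))] at h3
    exact h3
  · intro y hy
    obtain ⟨w, hyw, hw⟩ := hy.exists_trajectory hb.le hT hτ
    -- The bound is applied to `f` itself: any solution stays where `F = f`, hence solves the
    -- truncated equation, whose solution is unique.
    have h2 := hM f τ w hτ hfx hw
    have h3 : delayResidual T hd hs A' p G (τ, w) = 0 := by
      rw [hiff τ hτ.2]
      filter_upwards [hw, ae_restrict_mem measurableSet_Ioo] with t h4 ht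
      rw [hFf _ (h2 t (Ioo_subset_Icc_self ht))]
      exact h4
    dsimp only
    rw [(existsUnique_residual_eq_zero hT.le hτ.1 hd hs A' p G).unique (hv τ hτ) h3]
    exact hyw
  · dsimp only
    rw [primitiveH1Zero_fst]
    filter_upwards [coeFn_bcfToL2 (a := -b) (c := T) (primitive 0 T (v τ))] with t ht
    rw [ht, extendInitial]
    split_ifs with h
    · rw [trajectory_of_nonpos _ _ h, primitive_zero_left _ h, sub_self]
    · rw [trajectory_of_nonneg _ _ (not_le.1 h).le, add_sub_cancel_left]
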